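/- **Setting.** Let $I\ge 1$, $J\ge 0$. Under testing condition $i=1,\dots,I$ there are stress factors $\boldsymbol x_i=(x_{i0},\dots,x_{iJ})\in\mathbb R^{J+1}$, an inspection time $\tau_i>0$ and $K_i$ devices; $K=K_1+\dots+K_I$. For $\boldsymbol\theta=(a_0,\dots,a_J,b_0,\dots,b_J)\in\mathbb R^{2(J+1)}$ put $\alpha_i=\exp(\sum_j a_jx_{ij})$, $\beta_i=\exp(\sum_j b_jx_{ij})$, $$F_i=\frac{\tau_i^{\beta_i}}{\tau_i^{\beta_i}+\alpha_i^{\beta_i}},\qquad R_i=1-F_i,\qquad \boldsymbol z_i=\Big(-\beta_i\boldsymbol x_i,\ \log\tfrac{\tau_i}{\alpha_i}\,\beta_i\boldsymbol x_i\Big).$$ The lifetimes of the $K$ devices are independent, those under condition $i$ having the log-logistic density $\beta_i\alpha_i^{\beta_i}t^{\beta_i-1}/(t^{\beta_i}+\alpha_i^{\beta_i})^2$, $t>0$, with $\alpha_i,\beta_i$ taken at the true parameter $\boldsymbol\theta_0$; $n_i$ is the number of devices under condition $i$ whose lifetime is at most $\tau_i$. Let $\gamma\ge 0$, and for probability vectors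 $p,q$ on $\{1,2\}$ let $D^*_\gamma(p,q)=\sum_y q_y^{\gamma+1}-\frac{\gamma+1}{\gamma}\sum_y p_yq_y^{\gamma}$ if $\gamma>0$ and $D_0^*(p,q)=-\sum_y p_y\log q_y$. With $\hat{\boldsymbol p}_i=(n_i/K_i,1-n_i/K_i)$ and $\boldsymbol\pi_i(\boldsymbol\theta)=(F_i,R_i)$ let $WD^*_\gamma(\boldsymbol\theta)=\sum_i\frac{K_i}{K}D^*_\gamma(\hat{\boldsymbol p}_i,\boldsymbol\pi_i(\boldsymbol\theta))$. The score is $$\boldsymbol U_\gamma(\boldsymbol\theta)=\sum_{i=1}^I (K_iF_i-n_i)\,\frac{\tau_i^{\beta_i\gamma}\alpha_i^{\beta_i}+\alpha_i^{\beta_i\gamma}\tau_i^{\beta_i}}{(\tau_i^{\beta_i}+\alpha_i^{\beta_i})^{\gamma+1}}\ \boldsymbol z_i ,$$ and $$\boldsymbol J_\gamma(\boldsymbol\theta)=\sum_i\tfrac{K_i}{K}(F_iR_i)^2(F_i^{\gamma-1}+R_i^{\gamma-1})\,\boldsymbol z_i\boldsymbol z_i^T,\qquad \boldsymbol K_\gamma(\boldsymbol\theta)=\sum_i\tfrac{K_i}{K}(F_iR_i)^3(F_i^{\gamma-1}+R_i^{\gamma-1})^2\,\boldsymbol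 z_i\boldsymbol z_i^T .$$ The null hypothesis is $H_0:\boldsymbol m(\boldsymbol\theta)=\boldsymbol 0_r$, where $\boldsymbol m:\mathbb R^{2(J+1)}\to\mathbb R^r$ is continuously differentiable near $\boldsymbol\theta_0$ and the $2(J+1)\times r$ matrix $\boldsymbol M(\boldsymbol\theta)=\partial\boldsymbol m^T(\boldsymbol\theta)/\partial\boldsymbol\theta$ has rank $r$ at $\boldsymbol\theta_0$. Put $\boldsymbol Q_\gamma=\boldsymbol J_\gamma^{-1}\boldsymbol M(\boldsymbol M^T\boldsymbol J_\gamma^{-1}\boldsymbol M)^{-1}$. The restricted weighted minimum density power divergence estimator (RWMDPDE) $\tilde{\boldsymbol\theta}_\gamma$ minimizes $WD^*_\gamma$ over $\Theta_0=\{\boldsymbol\theta:\boldsymbol m(\boldsymbol\theta)=\boldsymbol 0_r\}$; its estimating equations are $\boldsymbol U_\gamma(\boldsymbol\theta)+\boldsymbol M(\boldsymbol\theta)\boldsymbol\lambda=\boldsymbol 0$, $\boldsymbol m(\boldsymbol\theta)=\boldsymbol 0_r$ for some $\boldsymbol\lambda\in\mathbb R^r$. The Rao-type statistic is $$R_K(\boldsymbol\theta)=K\,\bar{\boldsymbol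 U}_\gamma^T\boldsymbol Q_\gamma\big(\boldsymbol Q_\gamma^T\boldsymbol K_\gamma\boldsymbol Q_\gamma\big)^{-1}\boldsymbol Q_\gamma^T\bar{\boldsymbol U}_\gamma,\qquad \bar{\boldsymbol U}_\gamma=\tfrac1K\boldsymbol U_\gamma ,$$ all terms being evaluated at $\boldsymbol\theta$. **Theorem.** Let $K\to\infty$ along a sequence of experiments with fixed conditions (fixed $I,\boldsymbol x_i,\tau_i$) such that $K_i/K\to w_i$ for each $i$, and assume that the limiting matrix $\boldsymbol J_\gamma(\boldsymbol\theta_0)$ (with $w_i$ in place of $K_i/K$) is nonsingular. Assume $H_0$, that is, $\boldsymbol m(\boldsymbol\theta_0)=\boldsymbol 0_r$. Then: 1. There are estimators, functions of the observed counts, that converge to $\boldsymbol\theta_0$ in probability and that, with probability tending to one, solve the restricted estimating equations and are local minimizers of $WD_\gamma^*$ on $\Theta_0$. 2. For every sequence $\tilde{\boldsymbol\theta}_\gamma$ of random vectors that converges to $\boldsymbol\theta_0$ in probability and solves the restricted estimating equations with probability tending to one, $$R_K(\tilde{\boldsymbol\theta}_\gamma)\ \xrightarrow[K\to\infty]{\mathcal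 L}\ \chi^2_r .$$ 3. The same convergence holds for every sequence $\tilde{\boldsymbol\theta}_\gamma$ of random vectors that, with probability tending to one, minimizes $WD^*_\gamma$ over $\Theta_0$, provided that it converges to $\boldsymbol\theta_0$ in probability or that $\boldsymbol\theta_0$ is a well-separated minimizer of the limiting objective on $\Theta_0$: with $H(\boldsymbol\theta)=\sum_i w_iD_\gamma^*(\boldsymbol\pi_i(\boldsymbol\theta_0),\boldsymbol\pi_i(\boldsymbol\theta))$, for every $\varepsilon>0$, $\inf\{H(\boldsymbol\theta):\boldsymbol\theta\in\Theta_0,\ \|\boldsymbol\theta-\boldsymbol\theta_0\|\ge\varepsilon\}>H(\boldsymbol\theta_0)$ (the infimum of the empty set being $+\infty$). -/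

import Mathlib

open MeasureTheory ProbabilityTheory Filter Topology

noncomputable section

namespace OneShot

/-- The experimental design: `I` testing conditions with vectors of stress factors
`x i = (x i 0, …, x i J)` and inspection times `τ i > 0`. -/
structure Design (I J : ℕ) where
  x : Fin I → Fin (J + 1) → ℝ
  τ : Fin I → ℝ
  τ_pos : ∀ i, 0 < τ i

/-- The parameter vector `θ = (a, b)` in `ℝ^(2(J+1))`: `a j = θ (Sum.inl j)` and
`b j = θ (Sum.inr j)`. -/
abbrev Params (J : ℕ) : Type := Fin (J + 1) ⊕ Fin (J + 1) → ℝ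

/-- Density of the log-logistic distribution with scale `α` and shape `β`. -/
def logLogisticPDF (α β t : ℝ) : ℝ :=
  if 0 < t then β * α ^ β * t ^ (β - 1) / (t ^ β + α ^ β) ^ 2 else 0

/-- The log-logistic distribution with scale `α` and shape `β`. -/
def logLogistic (α β : ℝ) : Measure ℝ :=
  volume.withDensity fun t => ENNReal.ofReal (logLogisticPDF α β t)

/-- The chi-squared distribution with `r` degrees of freedom: the law of the sum of squares of
`r` independent standard normal variables. -/
def chiSquared (r : ℕ) : Measure ℝ :=
  (Measure.pi fun _ : Fin r => gaussianReal 0 1).map fun z => ∑ s, z s ^ 2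

instance chiSquared.isProbabilityMeasure (r : ℕ) : IsProbabilityMeasure (chiSquared r) :=
  Measure.isProbabilityMeasure_map (Measurable.aemeasurable (by fun_prop))

section Model

variable {I J : ℕ} (D : Design I J)

/-- Scale parameter `α i = exp (∑ j, a j * x i j)`. -/
def scale (θ : Params J) (i : Fin I) : ℝ := Real.exp (∑ j, θ (Sum.inl j) * D.x i j)

/-- Shape parameter `β i = exp (∑ j, b j * x i j)`. -/
def shape (θ : Params J) (i : Fin I) : ℝ := Real.exp (∑ j, θ (Sum.inr j) * D.x i j)

/-- Probability `F` of failure before the inspection time under condition `i`. -/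
def failProb (θ : Params J) (i : Fin I) : ℝ :=
  D.τ i ^ shape D θ i / (D.τ i ^ shape D θ i + scale D θ i ^ shape D θ i)

/-- Reliability `R` at the inspection time under condition `i`. -/
def relProb (θ : Params J) (i : Fin I) : ℝ :=
  scale D θ i ^ shape D θ i / (D.τ i ^ shape D θ i + scale D θ i ^ shape D θ i)

/-- The theoretical probability vector `π i = (F, R)`. -/
def modelProb (θ : Params J) (i : Fin I) : Fin 2 → ℝ := ![failProb D θ i, relProb D θ i]

/-- The number of failures under each condition, as a function of the lifetimes. -/
def failures {K : Fin I → ℕ} (T : (i : Fin I) → Fin (K i) → ℝ) (i : Fin I) : ℕ :=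
  (Finset.univ.filter fun k : Fin (K i) => T i k ≤ D.τ i).card

/-- The total number of devices. -/
def total (K : Fin I → ℕ) : ℝ := ∑ i, (K i : ℝ)

/-- The proportions `K i / K` of devices under each condition. -/
def weights (K : Fin I → ℕ) (i : Fin I) : ℝ := (K i : ℝ) / total K

/-- The empirical probability vector `(n i / K i, 1 - n i / K i)`. -/
def empProb (K N : Fin I → ℕ) (i : Fin I) : Fin 2 → ℝ :=
  ![(N i : ℝ) / K i, 1 - (N i : ℝ) / K i]

/-- The density power divergence between `p` and `q` with tuning parameter `γ`, up to the term
that does not depend on `q`; for `γ = 0` it is the Kullback-Leibler divergence, again up to the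
term that does not depend on `q`. -/
def dpd (γ : ℝ) (p q : Fin 2 → ℝ) : ℝ :=
  if γ = 0 then -∑ y, p y * Real.log (q y)
  else ∑ y, q y ^ (γ + 1) - (γ + 1) / γ * ∑ y, p y * q y ^ γ

/-- The weighted divergence `∑ i, w i * dpd γ (p i) (π i θ)`. -/
def weightedDPD (γ : ℝ) (w : Fin I → ℝ) (p : Fin I → Fin 2 → ℝ) (θ : Params J) : ℝ :=
  ∑ i, w i * dpd γ (p i) (modelProb D θ i)

/-- The objective function of the WMDPDE for `N i` failures among `K i` devices. -/
def objective (γ : ℝ) (K N : Fin I → ℕ) (θ : Params J) : ℝ :=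
  weightedDPD D γ (weights K) (empProb K N) θ

/-- The vector `(-β i x i, log (τ i / α i) β i x i)`. -/
def scoreVec (θ : Params J) (i : Fin I) : Params J :=
  Sum.elim (fun j => -shape D θ i * D.x i j)
    (fun j => Real.log (D.τ i / scale D θ i) * shape D θ i * D.x i j)

/-- The score `U_γ(θ)`. -/
def score (γ : ℝ) (K N : Fin I → ℕ) (θ : Params J) : Params J :=
  ∑ i, ((K i * failProb D θ i - N i) *
    ((D.τ i ^ (shape D θ i * γ) * scale D θ i ^ shape D θ i
      + scale D θ i ^ (shape D θ i * γ) * D.τ i ^ shape D θ i)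
      / (D.τ i ^ shape D θ i + scale D θ i ^ shape D θ i) ^ (γ + 1))) • scoreVec D θ i

/-- The matrix `M i`, the outer product of `scoreVec` with itself, written in blocks. -/
def blockM (θ : Params J) (i : Fin I) :
    Matrix (Fin (J + 1) ⊕ Fin (J + 1)) (Fin (J + 1) ⊕ Fin (J + 1)) ℝ :=
  let β := shape D θ i
  let L := Real.log (D.τ i / scale D θ i)
  let xx := Matrix.vecMulVec (D.x i) (D.x i)
  Matrix.fromBlocks (β ^ 2 • xx) ((-L * β ^ 2) • xx) ((-L * β ^ 2) • xx) ((L * β) ^ 2 • xx)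

/-- The matrix `J_γ(θ)` for the proportions `w` of devices. -/
def matJ (γ : ℝ) (w : Fin I → ℝ) (θ : Params J) :
    Matrix (Fin (J + 1) ⊕ Fin (J + 1)) (Fin (J + 1) ⊕ Fin (J + 1)) ℝ :=
  ∑ i, (w i * (relProb D θ i * failProb D θ i) ^ 2
    * (failProb D θ i ^ (γ - 1) + relProb D θ i ^ (γ - 1))) • blockM D θ i

/-- The matrix `K_γ(θ)` for the proportions `w` of devices. -/
def matK (γ : ℝ) (w : Fin I → ℝ) (θ : Params J) :
    Matrix (Fin (J + 1) ⊕ Fin (J + 1)) (Fin (J + 1) ⊕ Fin (J + 1)) ℝ :=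
  ∑ i, (w i * (failProb D θ i ^ (γ - 1) + relProb D θ i ^ (γ - 1)) ^ 2
    * failProb D θ i ^ 3 * relProb D θ i ^ 3) • blockM D θ i

variable {r : ℕ} (m : Params J → Fin r → ℝ)

/-- The `2(J+1) × r` matrix `M(θ) = ∂mᵀ(θ)/∂θ`. -/
def matM (θ : Params J) : Matrix (Fin (J + 1) ⊕ Fin (J + 1)) (Fin r) ℝ :=
  Matrix.of fun p s => fderiv ℝ m θ (Pi.single p 1) s

/-- The matrix `Q_γ(θ) = J⁻¹ M (Mᵀ J⁻¹ M)⁻¹`. -/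
def matQ (γ : ℝ) (w : Fin I → ℝ) (θ : Params J) :
    Matrix (Fin (J + 1) ⊕ Fin (J + 1)) (Fin r) ℝ :=
  (matJ D γ w θ)⁻¹ * matM m θ * ((matM m θ).transpose * (matJ D γ w θ)⁻¹ * matM m θ)⁻¹

/-- `θ` is a restricted WMDPDE: it minimizes the objective function over the restricted parameter
space `{θ | m θ = 0}`. -/
def IsRWMDPDE (γ : ℝ) (K N : Fin I → ℕ) (θ : Params J) : Prop :=
  m θ = 0 ∧ IsMinOn (objective D γ K N) {θ' | m θ' = 0} θ

/-- `θ` solves the restricted estimating equations `U_γ(θ) + M(θ) ℓ = 0`, `m(θ) = 0` for some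
vector `ℓ` of Lagrange multipliers. -/
def IsRestrictedRoot (γ : ℝ) (K N : Fin I → ℕ) (θ : Params J) : Prop :=
  (∃ l : Fin r → ℝ, score D γ K N θ + (matM m θ).mulVec l = 0) ∧ m θ = 0

/-- The Rao-type statistic `K Ūᵀ Q (Qᵀ K_γ Q)⁻¹ Qᵀ Ū` at `θ`, with the averaged score
`Ū = U_γ(θ) / K`. -/
def raoStat (γ : ℝ) (K N : Fin I → ℕ) (θ : Params J) : ℝ :=
  let Q := matQ D m γ (weights K) θ
  let v := Q.transpose.mulVec ((total K)⁻¹ • score D γ K N θ)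
  total K * dotProduct v ((Q.transpose * matK D γ (weights K) θ * Q)⁻¹.mulVec v)

/-- `θ₀` is a well-separated minimizer, over `{θ | m θ = 0}`, of the weighted divergence from the
true model, the proportions of devices being `w`. -/
def IsWellSeparated (γ : ℝ) (w : Fin I → ℝ) (θ₀ : Params J) : Prop :=
  ∀ ε > 0, ∃ δ > 0, ∀ θ, m θ = 0 → ε ≤ dist θ θ₀ →
    weightedDPD D γ w (modelProb D θ₀) θ₀ + δ ≤ weightedDPD D γ w (modelProb D θ₀) θ

end Model

end OneShot

end

/-! The failure probability under condition `i` is the logistic function of the log-odds `s_i = β_i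
log (τ_i / α_i)`, and `z_i` is the gradient of `s_i`. So the objective is a sum of functions of the
`s_i`, its gradient is `γ + 1` times the averaged score `Ū`, and `Ū(θ) = Ū(θ₀) + J (θ - θ₀) + o(‖θ -
θ₀‖)` near `θ₀` (`meanScore_sub_isLittleO`).

At a restricted root `Ū` lies in the range of `M`, and `Qᵀ M = 1`, so `Qᵀ Ū` carries all of `Ū`.
Moreover `Qᵀ J = (Mᵀ J⁻¹ M)⁻¹ Mᵀ`, and `Mᵀ (θ - θ₀)` is negligible because `m` vanishes at both
points. Hence `Qᵀ Ū` at the root agrees to first order with `Qᵀ Ū` at `θ₀`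
(`projectedScore_expansion`), and the statistic is asymptotically a fixed quadratic form in the
residuals `n_i / K - (K_i / K) F_i(θ₀)`. These obey a central limit theorem
(`tendstoInDistribution_residual`) under which `√K Ū(θ₀)` has limiting covariance `K_γ`. The limit
is therefore `Wᵀ B⁻¹ W` with `W` normal of covariance `B = Qᵀ K_γ Q`, which is chi-squared
(`map_limitQuad`).

Nonsingularity of `J` makes the log-odds identify `θ` near `θ₀`, so `θ₀` is a strict local minimizer
of the limiting objective. Minimizers over a small compact piece of the restricted set are then
consistent, eventually local minimizers on the whole restricted set, and roots by the Lagrange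
multiplier rule. Well-separatedness replaces compactness for global minimizers.

Statements in probability become limits along `probFilter` on `ℕ × Ω`, so the expansions are
ordinary `o`/`O` calculus along a filter. -/

noncomputable section

/-! ### The model in terms of log-odds; the score as a gradient. -/

namespace OneShot

open Real (sigmoid)

variable {I J : ℕ} (D : Design I J)

/-- The log-odds of a failure before the inspection time. -/
def logit (θ : Params J) (i : Fin I) : ℝ :=
  shape D θ i * Real.log (D.τ i / scale D θ i)

lemma shape_pos (θ : Params J) (i : Fin I) : 0 < shape D θ i := Real.exp_pos _

lemma scale_pos (θ : Params J) (i : Fin I) : 0 < scale D θ i := Real.exp_pos _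

lemma failProb_eq_sigmoid (θ : Params J) (i : Fin I) :
    failProb D θ i = sigmoid (logit D θ i) := by
  have hτ := D.τ_pos i
  have hα := scale_pos D θ i
  have h1 := Real.rpow_pos_of_pos hτ (shape D θ i)
  have h2 := Real.rpow_pos_of_pos hα (shape D θ i)
  have : Real.exp (-logit D θ i) = scale D θ i ^ shape D θ i / D.τ i ^ shape D θ i := by
    rw [logit, Real.rpow_def_of_pos hτ, Real.rpow_def_of_pos hα, ← Real.exp_sub,
      Real.log_div hτ.ne' hα.ne']
    congr 1; ring
  rw [failProb, Real.sigmoid_def, this]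
  field_simp

lemma relProb_eq_one_sub (θ : Params J) (i : Fin I) :
    relProb D θ i = 1 - failProb D θ i := by
  have h1 := Real.rpow_pos_of_pos (D.τ_pos i) (shape D θ i)
  have h2 := Real.rpow_pos_of_pos (scale_pos D θ i) (shape D θ i)
  rw [failProb, relProb]
  field_simp
  ring

lemma failProb_pos (θ : Params J) (i : Fin I) : 0 < failProb D θ i := by
  rw [failProb_eq_sigmoid]; exact Real.sigmoid_pos _

lemma failProb_lt_one (θ : Params J) (i : Fin I) : failProb D θ i < 1 := by
  rw [failProb_eq_sigmoid]; exact Real.sigmoid_lt_one _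

lemma relProb_pos (θ : Params J) (i : Fin I) : 0 < relProb D θ i := by
  rw [relProb_eq_one_sub]; exact sub_pos.2 (failProb_lt_one D θ i)

/-- The factor `F ^ γ R + R ^ γ F` as a function of the log-odds. -/
def scoreFactor (γ s : ℝ) : ℝ :=
  sigmoid s ^ γ * (1 - sigmoid s) + (1 - sigmoid s) ^ γ * sigmoid s

lemma scoreFactor_pos (γ s : ℝ) : 0 < scoreFactor γ s := by
  have h0 := Real.sigmoid_pos s
  have h1 : 0 < 1 - sigmoid s := sub_pos.2 (Real.sigmoid_lt_one s)
  unfold scoreFactor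
  positivity

lemma contDiff_sigmoid_one : ContDiff ℝ 1 sigmoid := contDiff_sigmoid.of_le le_top

lemma contDiff_scoreFactor (γ : ℝ) : ContDiff ℝ 1 (scoreFactor γ) := by
  have h0 : ∀ s, sigmoid s ≠ 0 := fun s => (Real.sigmoid_pos s).ne'
  have h1 : ∀ s, 1 - sigmoid s ≠ 0 := fun s => (sub_pos.2 (Real.sigmoid_lt_one s)).ne'
  have hs := contDiff_sigmoid_one
  have hs' : ContDiff ℝ 1 fun s => 1 - sigmoid s := contDiff_const.sub hs
  exact ((hs.rpow_const_of_ne h0).mul hs').add ((hs'.rpow_const_of_ne h1).mul hs)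

lemma scoreFactor_logit (γ : ℝ) (θ : Params J) (i : Fin I) :
    scoreFactor γ (logit D θ i) =
      (D.τ i ^ (shape D θ i * γ) * scale D θ i ^ shape D θ i
        + scale D θ i ^ (shape D θ i * γ) * D.τ i ^ shape D θ i)
        / (D.τ i ^ shape D θ i + scale D θ i ^ shape D θ i) ^ (γ + 1) := by
  have hτ := D.τ_pos i
  have hα := scale_pos D θ i
  have h1 := Real.rpow_pos_of_pos hτ (shape D θ i)
  have h2 := Real.rpow_pos_of_pos hα (shape D θ i)
  rw [scoreFactor, ← failProb_eq_sigmoid, ← relProb_eq_one_sub, failProb, relProb,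
    Real.div_rpow h1.le (by positivity), Real.div_rpow h2.le (by positivity),
    Real.rpow_add_one (by positivity), Real.rpow_mul hτ.le, Real.rpow_mul hα.le]
  have := Real.rpow_pos_of_pos (add_pos h1 h2) γ
  field_simp

/-- Reconciles the weights `F ^ (γ - 1) + R ^ (γ - 1)` of `matJ` and `matK` with the factor in the
score. -/
lemma sq_mul_rpow_sub_one (γ s : ℝ) :
    ((1 - sigmoid s) * sigmoid s) * (sigmoid s ^ (γ - 1) + (1 - sigmoid s) ^ (γ - 1)) =
      scoreFactor γ s := by
  have h0 := Real.sigmoid_pos s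
  have h1 : 0 < 1 - sigmoid s := sub_pos.2 (Real.sigmoid_lt_one s)
  rw [scoreFactor, Real.rpow_sub_one h0.ne', Real.rpow_sub_one h1.ne']
  field_simp

lemma blockM_eq_vecMulVec (θ : Params J) (i : Fin I) :
    blockM D θ i = Matrix.vecMulVec (scoreVec D θ i) (scoreVec D θ i) := by
  ext p q
  rcases p with p | p <;> rcases q with q | q <;>
    simp [blockM, Matrix.vecMulVec_apply, scoreVec] <;> ring

/-- The summand of the score belonging to one condition, without the residual. -/
def scoreTerm (γ : ℝ) (θ : Params J) (i : Fin I) : Params J :=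
  scoreFactor γ (logit D θ i) • scoreVec D θ i

/-- Since `F R z` is the gradient of `F`, this form exhibits `J` as the derivative of the averaged
score when the residuals vanish. -/
lemma matJ_eq (γ : ℝ) (w : Fin I → ℝ) (θ : Params J) :
    matJ D γ w θ = ∑ i, (w i * (failProb D θ i * relProb D θ i)) •
      Matrix.vecMulVec (scoreTerm D γ θ i) (scoreVec D θ i) := by
  unfold matJ scoreTerm
  refine Finset.sum_congr rfl fun i _ => ?_
  rw [blockM_eq_vecMulVec, Matrix.smul_vecMulVec, smul_smul, ← sq_mul_rpow_sub_one,
    relProb_eq_one_sub, failProb_eq_sigmoid]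
  congr 1; ring

/-- Here `w i * (F * R)` is the limiting variance of a scaled residual, so `K` is the limiting
covariance of the scaled averaged score. -/
lemma matK_eq (γ : ℝ) (w : Fin I → ℝ) (θ : Params J) :
    matK D γ w θ = ∑ i, (w i * (failProb D θ i * relProb D θ i)) •
      Matrix.vecMulVec (scoreTerm D γ θ i) (scoreTerm D γ θ i) := by
  unfold matK scoreTerm
  refine Finset.sum_congr rfl fun i _ => ?_
  rw [blockM_eq_vecMulVec, Matrix.smul_vecMulVec, Matrix.vecMulVec_smul, smul_smul, smul_smul,
    ← sq_mul_rpow_sub_one, relProb_eq_one_sub, failProb_eq_sigmoid]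
  congr 1; ring

/-- The averaged score, as a function of the proportions `c i` of devices and `ν i` of failures
in the whole sample. -/
def meanScore (γ : ℝ) (θ : Params J) (c ν : Fin I → ℝ) : Params J :=
  ∑ i, (c i * failProb D θ i - ν i) • scoreTerm D γ θ i

/-- The numbers of failures as proportions of the whole sample. -/
def failFreq (K N : Fin I → ℕ) (i : Fin I) : ℝ := (N i : ℝ) / total K

lemma inv_total_smul_score (γ : ℝ) (K N : Fin I → ℕ) (θ : Params J) :
    (total K)⁻¹ • score D γ K N θ = meanScore D γ θ (weights K) (failFreq K N) := by
  unfold score meanScore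
  rw [Finset.smul_sum]
  refine Finset.sum_congr rfl fun i _ => ?_
  rw [← scoreFactor_logit, scoreTerm, smul_smul, smul_smul, weights, failFreq]
  congr 1; ring

/-- The contribution of one condition to the objective function, in terms of the log-odds `s`. -/
def divTerm (γ c ν s : ℝ) : ℝ :=
  if γ = 0 then -(ν * Real.log (sigmoid s) + (c - ν) * Real.log (1 - sigmoid s))
  else c * (sigmoid s ^ (γ + 1) + (1 - sigmoid s) ^ (γ + 1)) -
    (γ + 1) / γ * (ν * sigmoid s ^ γ + (c - ν) * (1 - sigmoid s) ^ γ)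

/-- The objective function in terms of the proportions `c` of devices and `ν` of failures. -/
def freqObjective (γ : ℝ) (c ν : Fin I → ℝ) (θ : Params J) : ℝ :=
  ∑ i, divTerm γ (c i) (ν i) (logit D θ i)

lemma mul_dpd_modelProb (γ c : ℝ) (p : Fin 2 → ℝ) (hp : p 0 + p 1 = 1) (θ : Params J)
    (i : Fin I) :
    c * dpd γ p (modelProb D θ i) = divTerm γ c (c * p 0) (logit D θ i) := by
  have h : p 1 = 1 - p 0 := by linarith
  unfold dpd divTerm modelProb
  simp only [Fin.sum_univ_two, Matrix.cons_val_zero, Matrix.cons_val_one, h,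
    relProb_eq_one_sub, failProb_eq_sigmoid]
  split_ifs <;> ring

lemma weightedDPD_modelProb (γ : ℝ) (w : Fin I → ℝ) (θ₀ θ : Params J) :
    weightedDPD D γ w (modelProb D θ₀) θ =
      freqObjective D γ w (fun i => w i * failProb D θ₀ i) θ := by
  refine Finset.sum_congr rfl fun i _ => ?_
  rw [mul_dpd_modelProb D γ _ _ (by simp [modelProb, relProb_eq_one_sub])]
  simp [modelProb]

lemma objective_eq (γ : ℝ) (K N : Fin I → ℕ) (hN : ∀ i, N i ≤ K i) (θ : Params J) :
    objective D γ K N θ = freqObjective D γ (weights K) (failFreq K N) θ := by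
  unfold objective weightedDPD freqObjective
  refine Finset.sum_congr rfl fun i _ => ?_
  rw [mul_dpd_modelProb D γ _ _ (by simp [empProb])]
  congr 1
  -- Without devices the weight is `0`, and `N i ≤ K i` is what makes the failure frequency `0` as
  -- well.
  rcases Nat.eq_zero_or_pos (K i) with h | h
  · have := hN i
    simp [weights, failFreq, h, show N i = 0 by omega]
  · have : (K i : ℝ) ≠ 0 := by positivity
    simp only [weights, failFreq, empProb, Matrix.cons_val_zero]
    field_simp

/-- Taking out `γ + 1` lets the Kullback-Leibler case obey the same formula. Strictness is needed
for the Lagrange multiplier rule. -/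
lemma hasStrictDerivAt_divTerm {γ : ℝ} (c ν s : ℝ) :
    HasStrictDerivAt (divTerm γ c ν) ((γ + 1) * ((c * sigmoid s - ν) * scoreFactor γ s)) s := by
  have h0 := Real.sigmoid_pos s
  have h1 : 0 < 1 - sigmoid s := sub_pos.2 (Real.sigmoid_lt_one s)
  have hd : HasStrictDerivAt sigmoid (sigmoid s * (1 - sigmoid s)) s := by
    have := (contDiff_sigmoid_one.contDiffAt (x := s)).hasStrictDerivAt one_ne_zero
    rwa [Real.deriv_sigmoid] at this
  have hd' : HasStrictDerivAt (fun s => 1 - sigmoid s) (-(sigmoid s * (1 - sigmoid s))) s :=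
    hd.const_sub 1
  rw [← sq_mul_rpow_sub_one]
  have hlog := hd.log h0.ne'
  have hlog' := hd'.log h1.ne'
  have hp (p : ℝ) := (Real.hasStrictDerivAt_rpow_const_of_ne h0.ne' p).comp s hd
  have hp' (p : ℝ) := (Real.hasStrictDerivAt_rpow_const_of_ne h1.ne' p).comp s hd'
  by_cases hγ : γ = 0
  · subst hγ
    have : divTerm 0 c ν = fun s => -(ν * Real.log (sigmoid s)
        + (c - ν) * Real.log (1 - sigmoid s)) := by
      ext s; simp [divTerm]
    rw [this]
    convert! ((hlog.const_mul ν).add (hlog'.const_mul (c - ν))).neg using 1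
    rw [zero_sub, Real.rpow_neg_one, Real.rpow_neg_one]
    field_simp
    ring
  · have : divTerm γ c ν = fun s => c * (sigmoid s ^ (γ + 1) + (1 - sigmoid s) ^ (γ + 1)) -
        (γ + 1) / γ * (ν * sigmoid s ^ γ + (c - ν) * (1 - sigmoid s) ^ γ) := by
      ext s; simp [divTerm, hγ]
    rw [this]
    convert! (((hp (γ + 1)).add (hp' (γ + 1))).const_mul c).sub
      ((((hp γ).const_mul ν).add ((hp' γ).const_mul (c - ν))).const_mul ((γ + 1) / γ)) using 1
    rw [add_sub_cancel_right, Real.rpow_sub_one h0.ne', Real.rpow_sub_one h1.ne']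
    field_simp
    ring

lemma contDiff_shape (i : Fin I) : ContDiff ℝ 1 fun θ => shape D θ i := by
  unfold shape; fun_prop

lemma contDiff_log_div_scale (i : Fin I) :
    ContDiff ℝ 1 fun θ => Real.log (D.τ i / scale D θ i) := by
  have : (fun θ => Real.log (D.τ i / scale D θ i)) =
      fun θ : Params J => Real.log (D.τ i) - ∑ j, θ (Sum.inl j) * D.x i j := by
    ext θ
    rw [Real.log_div (D.τ_pos i).ne' (scale_pos D θ i).ne', scale, Real.log_exp]
  rw [this]; fun_prop

lemma contDiff_logit (i : Fin I) : ContDiff ℝ 1 fun θ => logit D θ i :=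
  (contDiff_shape D i).mul (contDiff_log_div_scale D i)

lemma contDiff_scoreVec (i : Fin I) : ContDiff ℝ 1 fun θ => scoreVec D θ i := by
  have h1 := contDiff_shape D i
  have h2 := contDiff_log_div_scale D i
  rw [contDiff_pi]
  rintro (j | j)
  · exact h1.neg.mul contDiff_const
  · exact (h2.mul h1).mul contDiff_const

lemma contDiff_scoreTerm (γ : ℝ) (i : Fin I) : ContDiff ℝ 1 fun θ => scoreTerm D γ θ i :=
  ((contDiff_scoreFactor γ).comp (contDiff_logit D i)).smul (contDiff_scoreVec D i)

lemma contDiff_failProb (i : Fin I) : ContDiff ℝ 1 fun θ => failProb D θ i := by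
  simp_rw [failProb_eq_sigmoid]
  exact contDiff_sigmoid_one.comp (contDiff_logit D i)

/-- The linear form `u ↦ z ⬝ᵥ u`. -/
def dotCLM (z : Params J) : Params J →L[ℝ] ℝ := ∑ p, z p • ContinuousLinearMap.proj p

@[simp] lemma dotCLM_apply (z u : Params J) : dotCLM z u = z ⬝ᵥ u := by
  simp [dotCLM, dotProduct]

/-- The log-odds are `exp (∑ b x) * (log τ - ∑ a x)`: the linear factor gives the block `-β x`, the
exponential the block `log (τ / α) β x`. -/
lemma hasStrictFDerivAt_logit (θ : Params J) (i : Fin I) :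
    HasStrictFDerivAt (fun θ => logit D θ i) (dotCLM (scoreVec D θ i)) θ := by
  have h := ((contDiff_logit D i).contDiffAt (x := θ)).hasStrictFDerivAt one_ne_zero
  have hb : HasFDerivAt (fun θ : Params J => ∑ j, θ (Sum.inr j) * D.x i j)
      (∑ j, D.x i j • (ContinuousLinearMap.proj (Sum.inr j) : Params J →L[ℝ] ℝ)) θ :=
    HasFDerivAt.fun_sum fun j _ => (hasFDerivAt_apply (Sum.inr j) θ).mul_const _
  have ha : HasFDerivAt (fun θ : Params J => ∑ j, θ (Sum.inl j) * D.x i j)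
      (∑ j, D.x i j • (ContinuousLinearMap.proj (Sum.inl j) : Params J →L[ℝ] ℝ)) θ :=
    HasFDerivAt.fun_sum fun j _ => (hasFDerivAt_apply (Sum.inl j) θ).mul_const _
  have e (θ : Params J) : Real.log (D.τ i / scale D θ i) =
      Real.log (D.τ i) - ∑ j, θ (Sum.inl j) * D.x i j := by
    rw [Real.log_div (D.τ_pos i).ne' (scale_pos D θ i).ne', scale, Real.log_exp]
  have hl : (fun θ => logit D θ i) = fun θ : Params J =>
      Real.exp (∑ j, θ (Sum.inr j) * D.x i j) *
        (Real.log (D.τ i) - ∑ j, θ (Sum.inl j) * D.x i j) := by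
    ext θ
    rw [logit, e, shape]
  have h' := hb.exp.mul (ha.const_sub (Real.log (D.τ i)))
  have key : fderiv ℝ (fun θ => logit D θ i) θ = dotCLM (scoreVec D θ i) := by
    rw [hl]
    refine h'.fderiv.trans ?_
    ext u
    simp only [dotCLM_apply, dotProduct, Fintype.sum_sum_type, scoreVec, Sum.elim_inl,
      Sum.elim_inr, e, shape]
    simp only [add_apply, smul_apply,
      neg_apply, sum_apply, ContinuousLinearMap.proj_apply,
      smul_eq_mul, smul_neg, Finset.mul_sum]
    rw [← Finset.sum_neg_distrib]
    congr 1 <;> refine Finset.sum_congr rfl fun j _ => ?_ <;> ring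
  rwa [key] at h

lemma hasFDerivAt_failProb (θ : Params J) (i : Fin I) :
    HasFDerivAt (fun θ => failProb D θ i)
      ((failProb D θ i * relProb D θ i) • dotCLM (scoreVec D θ i)) θ := by
  simp_rw [relProb_eq_one_sub, failProb_eq_sigmoid]
  exact (Real.hasDerivAt_sigmoid _).comp_hasFDerivAt θ (hasStrictFDerivAt_logit D θ i).hasFDerivAt

lemma hasStrictFDerivAt_freqObjective (γ : ℝ) (c ν : Fin I → ℝ) (θ : Params J) :
    HasStrictFDerivAt (freqObjective D γ c ν) ((γ + 1) • dotCLM (meanScore D γ θ c ν)) θ := by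
  have h := HasStrictFDerivAt.fun_sum (u := Finset.univ) fun i (_ : i ∈ Finset.univ) =>
    (hasStrictDerivAt_divTerm (γ := γ) (c i) (ν i) (logit D θ i)).comp_hasStrictFDerivAt θ
      (hasStrictFDerivAt_logit D θ i)
  convert! h using 1
  ext u
  simp only [smul_apply, dotCLM_apply, meanScore, sum_dotProduct,
    sum_apply, scoreTerm, smul_dotProduct, smul_eq_mul, failProb_eq_sigmoid,
    Finset.mul_sum]
  refine Finset.sum_congr rfl fun i _ => ?_
  ring

end OneShot
end
noncomputable section

/-! ### Limits and `o`/`O` estimates for matrices along a filter. -/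

section MatrixAsymptotics

open Asymptotics Matrix

variable {X m n p : Type*} {l : Filter X}

lemma Filter.Tendsto.matrix_mul' [Fintype n] {A : X → Matrix m n ℝ} {B : X → Matrix n p ℝ}
    {A₀ : Matrix m n ℝ} {B₀ : Matrix n p ℝ} (hA : Tendsto A l (𝓝 A₀)) (hB : Tendsto B l (𝓝 B₀)) :
    Tendsto (fun x => A x * B x) l (𝓝 (A₀ * B₀)) :=
  ((continuous_fst.matrix_mul continuous_snd).tendsto (A₀, B₀)).comp (hA.prodMk_nhds hB)

lemma Filter.Tendsto.matrix_transpose' {A : X → Matrix m n ℝ} {A₀ : Matrix m n ℝ}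
    (hA : Tendsto A l (𝓝 A₀)) : Tendsto (fun x => (A x)ᵀ) l (𝓝 A₀ᵀ) :=
  (continuous_id.matrix_transpose.tendsto A₀).comp hA

lemma Filter.Tendsto.matrix_inv' [Fintype n] [DecidableEq n] {A : X → Matrix n n ℝ} {A₀ : Matrix n n ℝ}
    (hA : Tendsto A l (𝓝 A₀)) (h : IsUnit A₀.det) : Tendsto (fun x => (A x)⁻¹) l (𝓝 A₀⁻¹) := by
  refine (continuousAt_matrix_inv A₀ ?_).tendsto.comp hA
  rw [Ring.inverse_eq_inv']
  exact continuousAt_inv₀ h.ne_zero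

lemma Filter.Tendsto.eventually_isUnit_det [Fintype n] [DecidableEq n] {A : X → Matrix n n ℝ}
    {A₀ : Matrix n n ℝ} (hA : Tendsto A l (𝓝 A₀)) (h : IsUnit A₀.det) :
    ∀ᶠ x in l, IsUnit (A x).det := by
  have := ((continuous_id.matrix_det.tendsto A₀).comp hA).eventually_ne h.ne_zero
  filter_upwards [this] with x hx
  exact isUnit_iff_ne_zero.2 hx

lemma Asymptotics.IsBigO.matrix_mulVec [Fintype m] [Fintype n] {A : X → Matrix m n ℝ} {A₀ : Matrix m n ℝ}
    (hA : Tendsto A l (𝓝 A₀)) {v : X → n → ℝ} {g : X → ℝ} (hv : v =O[l] g) :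
    (fun x => A x *ᵥ v x) =O[l] g := by
  refine isBigO_pi.2 fun i => IsBigO.fun_sum fun j _ => ?_
  have h1 : (fun x => A x i j) =O[l] (fun _ => (1 : ℝ)) :=
    (tendsto_pi_nhds.1 (tendsto_pi_nhds.1 hA i) j).isBigO_one ℝ
  simpa using h1.mul (isBigO_pi.1 hv j)

lemma Asymptotics.IsLittleO.matrix_mulVec [Fintype m] [Fintype n] {A : X → Matrix m n ℝ} {A₀ : Matrix m n ℝ}
    (hA : Tendsto A l (𝓝 A₀)) {v : X → n → ℝ} {g : X → ℝ} (hv : v =o[l] g) :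
    (fun x => A x *ᵥ v x) =o[l] g := by
  refine isLittleO_pi.2 fun i => IsLittleO.fun_sum fun j _ => ?_
  have h1 : (fun x => A x i j) =O[l] (fun _ => (1 : ℝ)) :=
    (tendsto_pi_nhds.1 (tendsto_pi_nhds.1 hA i) j).isBigO_one ℝ
  simpa using h1.mul_isLittleO (isLittleO_pi.1 hv j)

lemma Filter.Tendsto.isLittleO_mulVec_sub [Fintype m] [Fintype n] {A : X → Matrix m n ℝ} {A₀ : Matrix m n ℝ}
    (hA : Tendsto A l (𝓝 A₀)) {v : X → n → ℝ} {g : X → ℝ} (hv : v =O[l] g) :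
    (fun x => A x *ᵥ v x - A₀ *ᵥ v x) =o[l] g := by
  refine isLittleO_pi.2 fun i => ?_
  simp_rw [← sub_mulVec]
  refine IsLittleO.fun_sum fun j _ => ?_
  have h1 : (fun x => (A x - A₀) i j) =o[l] (fun _ => (1 : ℝ)) := by
    rw [isLittleO_one_iff]
    have h := tendsto_pi_nhds.1 (tendsto_pi_nhds.1 hA i) j
    simpa using h.sub_const (A₀ i j)
  simpa using h1.mul_isBigO (isBigO_pi.1 hv j)

lemma Asymptotics.IsLittleO.dotProduct [Fintype n] {a b : X → n → ℝ} {f g : X → ℝ} (ha : a =o[l] f)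
    (hb : b =O[l] g) : (fun x => a x ⬝ᵥ b x) =o[l] fun x => f x * g x :=
  IsLittleO.fun_sum fun j _ => (isLittleO_pi.1 ha j).mul_isBigO (isBigO_pi.1 hb j)

end MatrixAsymptotics

/-! ### Definiteness of `J` and `K`, linearization of the score, algebra of `Q`. -/

namespace OneShot

open Asymptotics Matrix

variable {I J r : ℕ} (D : Design I J)

lemma continuous_matJ (γ : ℝ) :
    Continuous fun p : (Fin I → ℝ) × Params J => matJ D γ p.1 p.2 := by
  simp_rw [matJ_eq, relProb_eq_one_sub]
  have h1 (i : Fin I) := (contDiff_failProb D i).continuous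
  have h2 (i : Fin I) := (contDiff_scoreTerm D γ i).continuous
  have h3 (i : Fin I) := (contDiff_scoreVec D i).continuous
  refine continuous_finsetSum _ fun i _ => ?_
  have := ((h2 i).comp (continuous_snd (X := Fin I → ℝ))).matrix_vecMulVec
    ((h3 i).comp continuous_snd)
  have h4 : Continuous fun p : (Fin I → ℝ) × Params J =>
      p.1 i * (failProb D p.2 i * (1 - failProb D p.2 i)) := by
    have := (h1 i).comp (continuous_snd (X := Fin I → ℝ))
    simp only [Function.comp_def] at this
    fun_prop
  exact h4.smul this

lemma continuous_matK (γ : ℝ) :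
    Continuous fun p : (Fin I → ℝ) × Params J => matK D γ p.1 p.2 := by
  simp_rw [matK_eq, relProb_eq_one_sub]
  have h1 (i : Fin I) := (contDiff_failProb D i).continuous
  have h2 (i : Fin I) := (contDiff_scoreTerm D γ i).continuous
  refine continuous_finsetSum _ fun i _ => ?_
  have := ((h2 i).comp (continuous_snd (X := Fin I → ℝ))).matrix_vecMulVec
    ((h2 i).comp continuous_snd)
  have h4 : Continuous fun p : (Fin I → ℝ) × Params J =>
      p.1 i * (failProb D p.2 i * (1 - failProb D p.2 i)) := by
    have := (h1 i).comp (continuous_snd (X := Fin I → ℝ))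
    simp only [Function.comp_def] at this
    fun_prop
  exact h4.smul this

lemma matJ_transpose (γ : ℝ) (w : Fin I → ℝ) (θ : Params J) :
    (matJ D γ w θ)ᵀ = matJ D γ w θ := by
  simp_rw [matJ_eq, scoreTerm, smul_vecMulVec, transpose_sum, transpose_smul, transpose_vecMulVec]

lemma matJ_mulVec (γ : ℝ) (w : Fin I → ℝ) (θ u : Params J) :
    matJ D γ w θ *ᵥ u = ∑ i, (w i * (failProb D θ i * relProb D θ i) * (scoreVec D θ i ⬝ᵥ u)) •
      scoreTerm D γ θ i := by
  rw [matJ_eq, sum_mulVec]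
  refine Finset.sum_congr rfl fun i _ => ?_
  rw [smul_mulVec, vecMulVec_mulVec]
  ext p
  simp; ring

/-- Identifiability: the `z i` with `w i ≠ 0` span the parameter space. Definiteness of `J` and `K`
and strictness of the minimum at `θ₀` all rest on it. -/
lemma scoreVec_dotProduct_eq_zero {γ : ℝ} {w : Fin I → ℝ} {θ : Params J}
    (hJ : IsUnit (matJ D γ w θ).det) {u : Params J}
    (h : ∀ i, w i * (scoreVec D θ i ⬝ᵥ u) = 0) : u = 0 := by
  have : matJ D γ w θ *ᵥ u = 0 := by
    rw [matJ_mulVec]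
    refine Finset.sum_eq_zero fun i _ => ?_
    rw [mul_right_comm, h i]; simp
  have h2 := congrArg ((matJ D γ w θ)⁻¹ *ᵥ ·) this
  simpa [mulVec_mulVec, nonsing_inv_mul _ hJ] using h2

lemma posDef_matJ {γ : ℝ} {w : Fin I → ℝ} {θ : Params J} (hw : ∀ i, 0 ≤ w i)
    (hJ : IsUnit (matJ D γ w θ).det) : (matJ D γ w θ).PosDef := by
  refine .of_dotProduct_mulVec_pos ?_ fun u hu => ?_
  · rw [IsHermitian, conjTranspose_eq_transpose_of_trivial, matJ_transpose]
  have e : star u ⬝ᵥ matJ D γ w θ *ᵥ u = ∑ i, w i * (failProb D θ i * relProb D θ i) *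
      scoreFactor γ (logit D θ i) * (scoreVec D θ i ⬝ᵥ u) ^ 2 := by
    rw [matJ_mulVec, star_trivial, dotProduct_sum]
    refine Finset.sum_congr rfl fun i _ => ?_
    rw [dotProduct_smul, scoreTerm, dotProduct_smul, dotProduct_comm u]
    simp only [smul_eq_mul]; ring
  have hc (i : Fin I) : 0 < (failProb D θ i * relProb D θ i) * scoreFactor γ (logit D θ i) :=
    mul_pos (mul_pos (failProb_pos D θ i) (relProb_pos D θ i)) (scoreFactor_pos _ _)
  have hn (i : Fin I) : 0 ≤ w i * (failProb D θ i * relProb D θ i) *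
      scoreFactor γ (logit D θ i) * (scoreVec D θ i ⬝ᵥ u) ^ 2 := by
    rw [mul_assoc (w i)]; exact mul_nonneg (mul_nonneg (hw i) (hc i).le) (sq_nonneg _)
  rw [e]
  refine (Finset.sum_nonneg fun i _ => hn i).lt_of_ne' fun h0 => hu ?_
  refine scoreVec_dotProduct_eq_zero D hJ fun i => ?_
  have := (Finset.sum_eq_zero_iff_of_nonneg fun i _ => hn i).1 h0 i (Finset.mem_univ i)
  rw [mul_assoc (w i)] at this
  rcases mul_eq_zero.1 this with h | h
  · rcases mul_eq_zero.1 h with h | h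
    · simp [h]
    · exact absurd h (hc i).ne'
  · simp [pow_eq_zero_iff two_ne_zero |>.1 h]

lemma dotProduct_matK_mulVec (γ : ℝ) (w : Fin I → ℝ) (θ u : Params J) :
    u ⬝ᵥ matK D γ w θ *ᵥ u = ∑ i, w i * (failProb D θ i * relProb D θ i) *
      (scoreTerm D γ θ i ⬝ᵥ u) ^ 2 := by
  rw [matK_eq, sum_mulVec, dotProduct_sum]
  refine Finset.sum_congr rfl fun i _ => ?_
  rw [smul_mulVec, vecMulVec_mulVec, dotProduct_smul, op_smul_eq_smul, dotProduct_smul,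
    dotProduct_comm u]
  simp only [smul_eq_mul]; ring

/-- `scoreTerm` is a positive multiple of `scoreVec`, so the two sums of squares vanish together and
`K` inherits definiteness from `J`. -/
lemma posDef_matK {γ : ℝ} {w : Fin I → ℝ} {θ : Params J} (hw : ∀ i, 0 ≤ w i)
    (hJ : IsUnit (matJ D γ w θ).det) : (matK D γ w θ).PosDef := by
  refine .of_dotProduct_mulVec_pos ?_ fun u hu => ?_
  · rw [IsHermitian, conjTranspose_eq_transpose_of_trivial, matK_eq]
    simp_rw [transpose_sum, transpose_smul, transpose_vecMulVec]
  have hc (i : Fin I) := mul_pos (failProb_pos D θ i) (relProb_pos D θ i)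
  have hn (i : Fin I) : 0 ≤ w i * (failProb D θ i * relProb D θ i) *
      (scoreTerm D γ θ i ⬝ᵥ u) ^ 2 :=
    mul_nonneg (mul_nonneg (hw i) (hc i).le) (sq_nonneg _)
  rw [star_trivial, dotProduct_matK_mulVec]
  refine (Finset.sum_nonneg fun i _ => hn i).lt_of_ne' fun h0 => hu ?_
  refine scoreVec_dotProduct_eq_zero D hJ fun i => ?_
  have := (Finset.sum_eq_zero_iff_of_nonneg fun i _ => hn i).1 h0 i (Finset.mem_univ i)
  have hs := (scoreFactor_pos γ (logit D θ i)).ne'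
  simpa [scoreTerm, smul_dotProduct, (failProb_pos D θ i).ne', (relProb_pos D θ i).ne', hs]
    using this

variable {X : Type*} {l : Filter X} {θ : X → Params J} {c ν : X → Fin I → ℝ} {θ₀ : Params J}
  {w : Fin I → ℝ}

/-- The averaged score is asymptotically linear near the true parameter. -/
lemma meanScore_sub_isLittleO (γ : ℝ) (hθ : Tendsto θ l (𝓝 θ₀)) (hc : Tendsto c l (𝓝 w))
    (hν : Tendsto ν l (𝓝 fun i => w i * failProb D θ₀ i)) :
    (fun x => meanScore D γ (θ x) (c x) (ν x) - meanScore D γ θ₀ (c x) (ν x) -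
      matJ D γ w θ₀ *ᵥ (θ x - θ₀)) =o[l] fun x => ‖θ x - θ₀‖ := by
  simp_rw [matJ_mulVec, meanScore, ← Finset.sum_sub_distrib]
  refine IsLittleO.fun_sum fun i _ => ?_
  set z := scoreVec D θ₀ i
  set h := fun θ => scoreTerm D γ θ i
  set F := fun θ => failProb D θ i
  set R := relProb D θ₀ i
  have hci := tendsto_pi_nhds.1 hc i
  have hνi := tendsto_pi_nhds.1 hν i
  have hh : Tendsto (fun x => h (θ x)) l (𝓝 (h θ₀)) :=
    ((contDiff_scoreTerm D γ i).continuous.tendsto θ₀).comp hθ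
  have hu : (fun x => θ x - θ₀) =O[l] fun x => ‖θ x - θ₀‖ := (isBigO_refl _ _).norm_right
  have hF : (fun x => F (θ x) - F θ₀ - F θ₀ * R * (z ⬝ᵥ (θ x - θ₀))) =o[l]
      fun x => ‖θ x - θ₀‖ := by
    have := ((hasFDerivAt_failProb D θ₀ i).isLittleO.comp_tendsto hθ).norm_right
    refine this.congr_left fun x => ?_
    simp [F, R, z]
  have hz : (fun x => F θ₀ * R * (z ⬝ᵥ (θ x - θ₀))) =O[l] fun x => ‖θ x - θ₀‖ := by
    have := (((F θ₀ * R) • dotCLM z).isBigO_comp (fun x => θ x - θ₀) l).norm_right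
    refine this.congr_left fun x => ?_
    simp
  have hd : (fun x => h (θ x) - h θ₀) =O[l] fun x => ‖θ x - θ₀‖ := by
    have hdiff : DifferentiableAt ℝ h θ₀ :=
      ((contDiff_scoreTerm D γ i).differentiable one_ne_zero) θ₀
    exact (hdiff.isBigO_sub.comp_tendsto hθ).norm_right
  have hch : Tendsto (fun x => c x i • h (θ x)) l (𝓝 (w i • h θ₀)) := hci.smul hh
  -- Three small products: Taylor remainder of `F` times a bounded factor, first-order change of `F`
  -- times a vanishing difference, and a vanishing residual times the change of `h`.
  have e (x : X) : (c x i * F (θ x) - ν x i) • h (θ x) - (c x i * F θ₀ - ν x i) • h θ₀ -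
      (w i * (F θ₀ * R) * (z ⬝ᵥ (θ x - θ₀))) • h θ₀ =
      (F (θ x) - F θ₀ - F θ₀ * R * (z ⬝ᵥ (θ x - θ₀))) • (c x i • h (θ x)) +
      (F θ₀ * R * (z ⬝ᵥ (θ x - θ₀))) • (c x i • h (θ x) - w i • h θ₀) +
      (c x i * F θ₀ - ν x i) • (h (θ x) - h θ₀) := by
    ext p
    simp only [Pi.sub_apply, Pi.add_apply, Pi.smul_apply, smul_eq_mul]
    ring
  refine IsLittleO.congr_left ?_ fun x => (e x).symm
  have t1 := hF.smul_isBigO (hch.isBigO_one ℝ)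
  have t2 := hz.smul_isLittleO ((isLittleO_one_iff ℝ).2 (tendsto_sub_nhds_zero_iff.2 hch))
  have h3 : Tendsto (fun x => c x i * F θ₀ - ν x i) l (𝓝 0) := by
    simpa [F] using (hci.mul_const (F θ₀)).sub hνi
  have t3 := ((isLittleO_one_iff ℝ).2 h3).smul_isBigO hd
  simp only [smul_eq_mul, mul_one, one_mul] at t1 t2 t3
  exact (t1.add t2).add t3

variable {m : Params J → Fin r → ℝ}

lemma fderiv_apply_eq_mulVec (θ u : Params J) : fderiv ℝ m θ u = (matM m θ)ᵀ *ᵥ u := by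
  ext s
  have : u = ∑ p, u p • Pi.single p (1 : ℝ) := by
    ext q; simp [Finset.sum_apply, Pi.single_apply]
  conv_lhs => rw [this]
  simp [map_sum, mulVec, dotProduct, matM, Finset.sum_apply, mul_comm]

lemma tendsto_matM (hm : ContDiffAt ℝ 1 m θ₀) (hθ : Tendsto θ l (𝓝 θ₀)) :
    Tendsto (fun x => matM m (θ x)) l (𝓝 (matM m θ₀)) := by
  have h := (hm.continuousAt_fderiv one_ne_zero).tendsto.comp hθ
  refine tendsto_pi_nhds.2 fun p => tendsto_pi_nhds.2 fun s => ?_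
  have h2 := ((ContinuousLinearMap.apply ℝ (Fin r → ℝ) (Pi.single p (1 : ℝ))).continuous.tendsto
    _).comp h
  exact tendsto_pi_nhds.1 h2 s

/-- As `m` vanishes at both points, the linear term is minus the Taylor remainder. -/
lemma transpose_mulVec_sub_isLittleO (hm : ContDiffAt ℝ 1 m θ₀) (hH0 : m θ₀ = 0)
    (hθ : Tendsto θ l (𝓝 θ₀)) (hroot : ∀ᶠ x in l, m (θ x) = 0) :
    (fun x => (matM m θ₀)ᵀ *ᵥ (θ x - θ₀)) =o[l] fun x => ‖θ x - θ₀‖ := by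
  have h := ((hm.differentiableAt one_ne_zero).hasFDerivAt.isLittleO.comp_tendsto hθ).norm_right
  refine (h.congr' ?_ EventuallyEq.rfl).neg_left.congr_left fun x => neg_neg _
  filter_upwards [hroot] with x hx
  simp [hx, hH0, fderiv_apply_eq_mulVec]

lemma mulVec_injective_of_rank (hrank : (matM m θ₀).rank = r) :
    Function.Injective (matM m θ₀).mulVec := by
  rw [mulVec_injective_iff]
  rw [linearIndependent_iff_card_eq_finrank_span, Set.finrank, ← rank_eq_finrank_span_cols, hrank]
  simp

/-- The matrix `Mᵀ J⁻¹ M`. -/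
def matG (m : Params J → Fin r → ℝ) (γ : ℝ) (w : Fin I → ℝ) (θ : Params J) :
    Matrix (Fin r) (Fin r) ℝ :=
  (matM m θ)ᵀ * (matJ D γ w θ)⁻¹ * matM m θ

lemma matQ_eq (γ : ℝ) (w : Fin I → ℝ) (θ : Params J) :
    matQ D m γ w θ = (matJ D γ w θ)⁻¹ * matM m θ * (matG D m γ w θ)⁻¹ := rfl

lemma matQ_transpose (γ : ℝ) (w : Fin I → ℝ) (θ : Params J) :
    (matQ D m γ w θ)ᵀ = (matG D m γ w θ)⁻¹ * (matM m θ)ᵀ * (matJ D γ w θ)⁻¹ := by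
  have hG : (matG D m γ w θ)ᵀ = matG D m γ w θ := by
    simp [matG, transpose_mul, transpose_nonsing_inv, matJ_transpose, Matrix.mul_assoc]
  rw [matQ_eq, transpose_mul, transpose_mul, transpose_nonsing_inv, transpose_nonsing_inv, hG,
    matJ_transpose, Matrix.mul_assoc]

/-- Thus `Qᵀ` reads the multipliers off a score of the form `-M λ`. -/
lemma matQ_transpose_mul_matM {γ : ℝ} {w : Fin I → ℝ} {θ : Params J}
    (hG : IsUnit (matG D m γ w θ).det) : (matQ D m γ w θ)ᵀ * matM m θ = 1 := by
  rw [matQ_transpose, Matrix.mul_assoc, Matrix.mul_assoc, ← Matrix.mul_assoc (matM m θ)ᵀ]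
  exact nonsing_inv_mul _ hG

/-- The projection turns the linear term `J (θ - θ₀)` into one that sees only `Mᵀ (θ - θ₀)`, which
is negligible under the restrictions. -/
lemma matQ_transpose_mul_matJ {γ : ℝ} {w : Fin I → ℝ} {θ : Params J}
    (hJ : IsUnit (matJ D γ w θ).det) :
    (matQ D m γ w θ)ᵀ * matJ D γ w θ = (matG D m γ w θ)⁻¹ * (matM m θ)ᵀ := by
  rw [matQ_transpose, Matrix.mul_assoc, nonsing_inv_mul _ hJ, Matrix.mul_one]

lemma isUnit_det_matG {γ : ℝ} (hw : ∀ i, 0 ≤ w i) (hJ : IsUnit (matJ D γ w θ₀).det)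
    (hrank : (matM m θ₀).rank = r) : IsUnit (matG D m γ w θ₀).det := by
  have h := (posDef_matJ D hw hJ).inv.conjTranspose_mul_mul_same (mulVec_injective_of_rank hrank)
  rw [conjTranspose_eq_transpose_of_trivial] at h
  exact (isUnit_iff_isUnit_det _).1 h.isUnit

/-- The asymptotic covariance matrix of the projected score. -/
def matB (m : Params J → Fin r → ℝ) (γ : ℝ) (w : Fin I → ℝ) (θ : Params J) :
    Matrix (Fin r) (Fin r) ℝ :=
  (matQ D m γ w θ)ᵀ * matK D γ w θ * matQ D m γ w θ

/-- `Mᵀ Q = 1` makes `Q` injective, and congruence by an injective matrix preserves definiteness. -/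
lemma posDef_matB {γ : ℝ} (hw : ∀ i, 0 ≤ w i) (hJ : IsUnit (matJ D γ w θ₀).det)
    (hrank : (matM m θ₀).rank = r) : (matB D m γ w θ₀).PosDef := by
  have hinj : Function.Injective (matQ D m γ w θ₀).mulVec := by
    have h := congrArg transpose (matQ_transpose_mul_matM D (isUnit_det_matG D hw hJ hrank))
    rw [transpose_mul, transpose_transpose, transpose_one] at h
    intro a b hab
    have := congrArg ((matM m θ₀)ᵀ *ᵥ ·) hab
    simpa [mulVec_mulVec, h] using this
  have h := (posDef_matK D hw hJ).conjTranspose_mul_mul_same hinj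
  rwa [conjTranspose_eq_transpose_of_trivial] at h

section Limits

variable {γ : ℝ} (hJ : IsUnit (matJ D γ w θ₀).det) (hm : ContDiffAt ℝ 1 m θ₀)
  (hθ : Tendsto θ l (𝓝 θ₀)) (hc : Tendsto c l (𝓝 w))
include hθ hc

lemma tendsto_matJ : Tendsto (fun x => matJ D γ (c x) (θ x)) l (𝓝 (matJ D γ w θ₀)) := by
  have h := ((continuous_matJ D γ).tendsto (w, θ₀)).comp (hc.prodMk_nhds hθ)
  exact h

lemma tendsto_matK : Tendsto (fun x => matK D γ (c x) (θ x)) l (𝓝 (matK D γ w θ₀)) := by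
  have h := ((continuous_matK D γ).tendsto (w, θ₀)).comp (hc.prodMk_nhds hθ)
  exact h

include hJ hm

lemma tendsto_matG : Tendsto (fun x => matG D m γ (c x) (θ x)) l (𝓝 (matG D m γ w θ₀)) :=
  ((tendsto_matM hm hθ).matrix_transpose'.matrix_mul' ((tendsto_matJ D hθ hc).matrix_inv' hJ)
    ).matrix_mul' (tendsto_matM hm hθ)

lemma tendsto_matQ (hG : IsUnit (matG D m γ w θ₀).det) :
    Tendsto (fun x => matQ D m γ (c x) (θ x)) l (𝓝 (matQ D m γ w θ₀)) :=
  (((tendsto_matJ D hθ hc).matrix_inv' hJ).matrix_mul' (tendsto_matM hm hθ)).matrix_mul'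
    ((tendsto_matG D hJ hm hθ hc).matrix_inv' hG)

lemma tendsto_matB (hG : IsUnit (matG D m γ w θ₀).det) :
    Tendsto (fun x => matB D m γ (c x) (θ x)) l (𝓝 (matB D m γ w θ₀)) := by
  have hQ := tendsto_matQ D hJ hm hθ hc hG
  exact (hQ.matrix_transpose'.matrix_mul' (tendsto_matK D hθ hc)).matrix_mul' hQ

end Limits

end OneShot
end
noncomputable section

namespace OneShot

open Asymptotics Matrix

/-! ### Expansion of the statistic at restricted roots. -/

section RootExpansion

variable {I J r : ℕ} (D : Design I J)
variable {X : Type*} {l : Filter X} {θ : X → Params J} {c ν : X → Fin I → ℝ} {θ₀ : Params J}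
  {w : Fin I → ℝ} {m : Params J → Fin r → ℝ}

/-- The Rao-type statistic divided by the sample size, in terms of proportions. -/
def raoQuad (m : Params J → Fin r → ℝ) (γ : ℝ) (c ν : Fin I → ℝ) (θ : Params J) : ℝ :=
  ((matQ D m γ c θ)ᵀ *ᵥ meanScore D γ θ c ν) ⬝ᵥ
    ((matB D m γ c θ)⁻¹ *ᵥ ((matQ D m γ c θ)ᵀ *ᵥ meanScore D γ θ c ν))

/-- The projected score at the true parameter, as a function of the residuals. -/
def limitVec (m : Params J → Fin r → ℝ) (γ : ℝ) (w : Fin I → ℝ) (θ₀ : Params J)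
    (y : Fin I → ℝ) : Fin r → ℝ :=
  (matQ D m γ w θ₀)ᵀ *ᵥ ∑ i, y i • scoreTerm D γ θ₀ i

/-- The quadratic form in the residuals that approximates the Rao-type statistic. -/
def limitQuad (m : Params J → Fin r → ℝ) (γ : ℝ) (w : Fin I → ℝ) (θ₀ : Params J)
    (y : Fin I → ℝ) : ℝ :=
  limitVec D m γ w θ₀ y ⬝ᵥ ((matB D m γ w θ₀)⁻¹ *ᵥ limitVec D m γ w θ₀ y)

lemma raoStat_eq (γ : ℝ) (K N : Fin I → ℕ) (θ : Params J) :
    raoStat D m γ K N θ = total K * raoQuad D m γ (weights K) (failFreq K N) θ := by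
  simp only [raoStat, raoQuad, inv_total_smul_score, matB]

/-- The residuals at the true parameter. -/
def residual (θ₀ : Params J) (c ν : Fin I → ℝ) (i : Fin I) : ℝ := ν i - c i * failProb D θ₀ i

lemma meanScore_true (γ : ℝ) (c ν : Fin I → ℝ) :
    meanScore D γ θ₀ c ν = -∑ i, residual D θ₀ c ν i • scoreTerm D γ θ₀ i := by
  rw [meanScore, ← Finset.sum_neg_distrib]
  refine Finset.sum_congr rfl fun i _ => ?_
  rw [residual, ← neg_smul, neg_sub]

lemma limitQuad_residual (γ : ℝ) (c ν : Fin I → ℝ) :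
    limitQuad D m γ w θ₀ (residual D θ₀ c ν) =
      ((matQ D m γ w θ₀)ᵀ *ᵥ meanScore D γ θ₀ c ν) ⬝ᵥ
        ((matB D m γ w θ₀)⁻¹ *ᵥ ((matQ D m γ w θ₀)ᵀ *ᵥ meanScore D γ θ₀ c ν)) := by
  simp only [limitQuad, limitVec, meanScore_true, mulVec_neg, neg_dotProduct, dotProduct_neg,
    neg_neg]

lemma eventually_meanScore_eq {γ : ℝ} (hJ : IsUnit (matJ D γ w θ₀).det)
    (hm : ContDiffAt ℝ 1 m θ₀) (hG : IsUnit (matG D m γ w θ₀).det)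
    (hθ : Tendsto θ l (𝓝 θ₀)) (hc : Tendsto c l (𝓝 w))
    (hroot : ∀ᶠ x in l, ∃ k, meanScore D γ (θ x) (c x) (ν x) + matM m (θ x) *ᵥ k = 0) :
    ∀ᶠ x in l, meanScore D γ (θ x) (c x) (ν x) =
      matM m (θ x) *ᵥ ((matQ D m γ (c x) (θ x))ᵀ *ᵥ meanScore D γ (θ x) (c x) (ν x)) := by
  filter_upwards [hroot, (tendsto_matG D hJ hm hθ hc).eventually_isUnit_det hG] with x ⟨k, hk⟩ hx
  have e : meanScore D γ (θ x) (c x) (ν x) = matM m (θ x) *ᵥ (-k) := by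
    rw [mulVec_neg]; exact eq_neg_of_add_eq_zero_left hk
  rw [e, mulVec_mulVec (-k), matQ_transpose_mul_matM D hx, one_mulVec]

/-- Only consistency of the roots is assumed. Their rate comes out of the argument, by bounding
displacement and projected score jointly. -/
lemma projectedScore_expansion {γ : ℝ} (hJ : IsUnit (matJ D γ w θ₀).det)
    (hm : ContDiffAt ℝ 1 m θ₀) (hH0 : m θ₀ = 0) (hG : IsUnit (matG D m γ w θ₀).det)
    (hθ : Tendsto θ l (𝓝 θ₀)) (hc : Tendsto c l (𝓝 w))
    (hν : Tendsto ν l (𝓝 fun i => w i * failProb D θ₀ i))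
    (hroot : ∀ᶠ x in l, (∃ k, meanScore D γ (θ x) (c x) (ν x) + matM m (θ x) *ᵥ k = 0) ∧
      m (θ x) = 0) :
    (fun x => (matQ D m γ (c x) (θ x))ᵀ *ᵥ meanScore D γ (θ x) (c x) (ν x)) =O[l]
        (fun x => ‖residual D θ₀ (c x) (ν x)‖) ∧
    (fun x => (matQ D m γ (c x) (θ x))ᵀ *ᵥ meanScore D γ (θ x) (c x) (ν x) -
        (matQ D m γ w θ₀)ᵀ *ᵥ meanScore D γ θ₀ (c x) (ν x)) =o[l]
        (fun x => ‖residual D θ₀ (c x) (ν x)‖) := by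
  set Q₀ := matQ D m γ w θ₀
  set U := fun x => meanScore D γ (θ x) (c x) (ν x)
  set S := fun x => meanScore D γ θ₀ (c x) (ν x)
  set V := fun x => (matQ D m γ (c x) (θ x))ᵀ *ᵥ U x
  set V₀ := fun x => Q₀ᵀ *ᵥ S x
  set u := fun x => θ x - θ₀
  set M := fun x => matM m (θ x)
  set J₀ := matJ D γ w θ₀
  set y := fun x => residual D θ₀ (c x) (ν x)
  have hM : Tendsto M l (𝓝 (matM m θ₀)) := tendsto_matM hm hθ
  have hUV : ∀ᶠ x in l, U x = M x *ᵥ V x :=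
    eventually_meanScore_eq D hJ hm hG hθ hc (hroot.mono fun x hx => hx.1)
  have hS : S =O[l] fun x => ‖y x‖ := by
    have : S = fun x => -∑ i, y x i • scoreTerm D γ θ₀ i := by
      ext1 x; exact meanScore_true D γ _ _
    rw [this]
    refine (IsBigO.fun_sum fun i _ => ?_).neg_left
    have h1 : (fun x => y x i) =O[l] fun x => ‖y x‖ :=
      (isBigO_pi.1 (isBigO_refl y l) i).norm_right
    simpa using h1.smul (isBigO_refl (fun _ : X => scoreTerm D γ θ₀ i) l |>.trans
      (isBigO_const_const _ (one_ne_zero (α := ℝ)) l))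
  have h1 : (fun x => U x - S x - J₀ *ᵥ u x) =o[l] fun x => ‖u x‖ :=
    meanScore_sub_isLittleO D γ hθ hc hν
  -- Neither component is yet known to be `O(‖y‖)`, so remainders are measured against the pair.
  set p := fun x => (u x, V x)
  have hup : (fun x => ‖u x‖) =O[l] p := (isBigO_fst_prod (f' := u) (g' := V)).norm_left
  have hVp : V =O[l] fun x => ‖p x‖ := (isBigO_snd_prod (f' := u) (g' := V)).norm_right
  have h1p : (fun x => U x - S x - J₀ *ᵥ u x) =o[l] fun x => ‖p x‖ :=
    (h1.trans_isBigO hup).norm_right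
  have h2 : (fun x => Q₀ᵀ *ᵥ (M x *ᵥ V x) - V x) =o[l] fun x => ‖p x‖ := by
    have h := (tendsto_const_nhds (x := Q₀ᵀ)).matrix_mul' hM
    rw [matQ_transpose_mul_matM D hG] at h
    refine (h.isLittleO_mulVec_sub hVp).congr_left fun x => ?_
    rw [one_mulVec, ← mulVec_mulVec]
  have h3 : (fun x => Q₀ᵀ *ᵥ (J₀ *ᵥ u x)) =o[l] fun x => ‖p x‖ := by
    have h := transpose_mulVec_sub_isLittleO hm hH0 hθ (hroot.mono fun x hx => hx.2)
    have h' := (h.trans_isBigO hup).norm_right.matrix_mulVec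
      (tendsto_const_nhds (x := (matG D m γ w θ₀)⁻¹))
    refine h'.congr_left fun x => ?_
    rw [mulVec_mulVec, mulVec_mulVec, matQ_transpose_mul_matJ D hJ]
  have h4 := h1p.matrix_mulVec (tendsto_const_nhds (x := Q₀ᵀ))
  have hV : (fun x => V x - V₀ x) =o[l] fun x => ‖p x‖ := by
    refine ((h4.add h3).sub h2).congr' ?_ EventuallyEq.rfl
    filter_upwards [hUV] with x hx
    rw [← hx, mulVec_sub, mulVec_sub]
    abel
  have hJM : Tendsto (fun x => J₀⁻¹ * M x) l (𝓝 (J₀⁻¹ * matM m θ₀)) :=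
    tendsto_const_nhds.matrix_mul' hM
  -- The linearized equation is solved for `u`, with `U = M V` and `V` replaced by `V₀`.
  have hu : (fun x => u x - ((J₀⁻¹ * M x) *ᵥ V₀ x - J₀⁻¹ *ᵥ S x)) =o[l] fun x => ‖p x‖ := by
    refine ((hV.matrix_mulVec hJM).sub
      (h1p.matrix_mulVec (tendsto_const_nhds (x := J₀⁻¹)))).congr' ?_ EventuallyEq.rfl
    filter_upwards [hUV] with x hx
    have e : J₀⁻¹ *ᵥ (J₀ *ᵥ u x) = u x := by
      rw [mulVec_mulVec, nonsing_inv_mul _ hJ, one_mulVec]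
    rw [mulVec_sub, mulVec_sub, mulVec_sub, e, hx, mulVec_mulVec (V x)]
    abel
  have hV₀ : V₀ =O[l] fun x => ‖y x‖ := hS.matrix_mulVec (tendsto_const_nhds (x := Q₀ᵀ))
  have hp : p =O[l] fun x => ‖y x‖ := by
    -- `p` is a main term of order `‖y‖` plus `o(p)`; absorbing the latter gives `p = O(‖y‖)`.
    have hb : (fun x => (u x - ((J₀⁻¹ * M x) *ᵥ V₀ x - J₀⁻¹ *ᵥ S x), V x - V₀ x)) =o[l] p :=
      (hu.prod_left hV).of_norm_right
    have ha : (fun x => ((J₀⁻¹ * M x) *ᵥ V₀ x - J₀⁻¹ *ᵥ S x, V₀ x)) =O[l] fun x => ‖y x‖ :=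
      ((hV₀.matrix_mulVec hJM).sub
        (hS.matrix_mulVec (tendsto_const_nhds (x := J₀⁻¹)))).prod_left hV₀
    refine hb.right_isBigO_sub.trans (ha.congr_left fun x => ?_)
    simp [p]
  exact ⟨hVp.trans hp.norm_left, hV.trans_isBigO hp.norm_left⟩

/-- At roots of the restricted estimating equations, the Rao-type statistic is asymptotically a
quadratic form in the residuals. -/
theorem raoQuad_sub_limitQuad_isLittleO {γ : ℝ} (hw : ∀ i, 0 ≤ w i)
    (hJ : IsUnit (matJ D γ w θ₀).det)
    (hm : ContDiffAt ℝ 1 m θ₀) (hH0 : m θ₀ = 0) (hrank : (matM m θ₀).rank = r)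
    (hθ : Tendsto θ l (𝓝 θ₀)) (hc : Tendsto c l (𝓝 w))
    (hν : Tendsto ν l (𝓝 fun i => w i * failProb D θ₀ i))
    (hroot : ∀ᶠ x in l, (∃ k, meanScore D γ (θ x) (c x) (ν x) + matM m (θ x) *ᵥ k = 0) ∧
      m (θ x) = 0) :
    (fun x => raoQuad D m γ (c x) (ν x) (θ x) -
      limitQuad D m γ w θ₀ (residual D θ₀ (c x) (ν x))) =o[l]
      fun x => ‖residual D θ₀ (c x) (ν x)‖ * ‖residual D θ₀ (c x) (ν x)‖ := by
  have hG := isUnit_det_matG D hw hJ hrank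
  obtain ⟨hV, hVV⟩ := projectedScore_expansion D hJ hm hH0 hG hθ hc hν hroot
  have hB := (tendsto_matB D hJ hm hθ hc hG).matrix_inv'
    ((isUnit_iff_isUnit_det _).1 (posDef_matB D hw hJ hrank).isUnit)
  simp_rw [limitQuad_residual, raoQuad]
  set V := fun x => (matQ D m γ (c x) (θ x))ᵀ *ᵥ meanScore D γ (θ x) (c x) (ν x)
  set V₀ := fun x => (matQ D m γ w θ₀)ᵀ *ᵥ meanScore D γ θ₀ (c x) (ν x)
  have hV₀ : V₀ =O[l] fun x => ‖residual D θ₀ (c x) (ν x)‖ :=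
    (hV.sub hVV.isBigO).congr_left fun x => by simp [V, V₀]
  -- Telescoping of `V ⬝ B⁻¹ V - V₀ ⬝ B₀⁻¹ V₀`: the left factor, the matrix and the right factor are
  -- exchanged one at a time.
  have t1 := hVV.dotProduct (hV.matrix_mulVec hB)
  have t2 := (hB.isLittleO_mulVec_sub hV).dotProduct hV₀
  have t3 := (hVV.matrix_mulVec (tendsto_const_nhds (x := (matB D m γ w θ₀)⁻¹))).dotProduct hV₀
  refine ((t1.add t2).add t3).congr_left fun x => ?_
  simp only [mulVec_sub, sub_dotProduct]
  rw [dotProduct_comm _ (V₀ x), dotProduct_comm _ (V₀ x), dotProduct_comm _ (V₀ x)]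
  simp only [V, V₀]
  ring

end RootExpansion

/-! ### Lagrange multipliers at restricted local minimizers. -/

section Lagrange

variable {I J r : ℕ} (D : Design I J) {θ₀ : Params J} {m : Params J → Fin r → ℝ}

lemma exists_multipliers {γ : ℝ} (hγ : 0 ≤ γ) {c ν : Fin I → ℝ} {θ : Params J}
    (hm : ContDiffAt ℝ 1 m θ) (hinj : Function.Injective (matM m θ).mulVec) (h0 : m θ = 0)
    (hmin : IsLocalMinOn (freqObjective D γ c ν) {θ | m θ = 0} θ) :
    ∃ k, meanScore D γ θ c ν + matM m θ *ᵥ k = 0 := by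
  have hext : IsLocalExtrOn (freqObjective D γ c ν) {x | ∀ s, m x s = m θ s} θ := by
    have : {x | ∀ s, m x s = m θ s} = {θ | m θ = 0} := by
      ext x; simp [h0, funext_iff]
    rw [this]; exact hmin.isExtr
  have hstrict := hm.hasStrictFDerivAt one_ne_zero
  obtain ⟨Λ, Λ₀, hne, hsum⟩ := hext.exists_multipliers_of_hasStrictFDerivAt
    (fun s => hasStrictFDerivAt_pi'.1 hstrict s) (hasStrictFDerivAt_freqObjective D γ c ν θ)
  have key : matM m θ *ᵥ Λ + (Λ₀ * (γ + 1)) • meanScore D γ θ c ν = 0 := by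
    ext p
    have h := DFunLike.congr_fun hsum (Pi.single p 1)
    simp only [_root_.add_apply, _root_.sum_apply, _root_.smul_apply, ContinuousLinearMap.comp_apply,
      ContinuousLinearMap.proj_apply, dotCLM_apply, dotProduct_single, mul_one, smul_eq_mul,
      _root_.zero_apply] at h
    simp only [Pi.add_apply, Pi.smul_apply, smul_eq_mul, Pi.zero_apply, mulVec, dotProduct, matM,
      of_apply]
    rw [← h, mul_assoc]
    congr 1
    exact Finset.sum_congr rfl fun s _ => mul_comm _ _
  -- Injectivity of `M` excludes the abnormal case, in which the objective drops out of the
  -- multiplier rule.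
  have hΛ₀ : Λ₀ ≠ 0 := by
    rintro rfl
    have : matM m θ *ᵥ Λ = matM m θ *ᵥ 0 := by simpa using key
    exact hne (by rw [hinj this]; rfl)
  have hc : Λ₀ * (γ + 1) ≠ 0 := mul_ne_zero hΛ₀ (by positivity)
  refine ⟨(Λ₀ * (γ + 1))⁻¹ • Λ, ?_⟩
  have := congrArg ((Λ₀ * (γ + 1))⁻¹ • ·) key
  simp only [smul_add, smul_smul, inv_mul_cancel₀ hc, one_smul, smul_zero] at this
  rw [mulVec_smul, add_comm, this]

/-- The neighbourhood does not depend on `c` and `ν`, hence not on the sample. Injectivity of `M`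
persists near `θ₀` because `Mᵀ J⁻¹ M` stays nonsingular, so that `Qᵀ` is still a left inverse. -/
lemma eventually_exists_multipliers {γ : ℝ} (hγ : 0 ≤ γ) {w : Fin I → ℝ} (hw : ∀ i, 0 ≤ w i)
    (hJ : IsUnit (matJ D γ w θ₀).det) (hm : ContDiffAt ℝ 1 m θ₀)
    (hrank : (matM m θ₀).rank = r) :
    ∀ᶠ θ in 𝓝 θ₀, ∀ c ν : Fin I → ℝ, m θ = 0 →
      IsLocalMinOn (freqObjective D γ c ν) {θ | m θ = 0} θ →
      ∃ k, meanScore D γ θ c ν + matM m θ *ᵥ k = 0 := by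
  have hG := (tendsto_matG D hJ hm tendsto_id tendsto_const_nhds).eventually_isUnit_det
    (isUnit_det_matG D hw hJ hrank)
  filter_upwards [hG, hm.eventually (by simp)] with θ hθ hmθ c ν h0 hmin
  refine exists_multipliers D hγ hmθ (fun a b hab => ?_) h0 hmin
  have e := matQ_transpose_mul_matM (θ := θ) D hθ
  have := congrArg ((matQ D m γ w θ)ᵀ *ᵥ ·) hab
  simpa [mulVec_mulVec, e] using this

end Lagrange

/-! ### Minimum of the limiting objective and consistency of minimizers. -/

section Argmin

open Real (sigmoid)

variable {I J r : ℕ} (D : Design I J) {θ₀ : Params J} {w : Fin I → ℝ}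

lemma continuous_freqObjective (γ : ℝ) (c ν : Fin I → ℝ) :
    Continuous (freqObjective D γ c ν) :=
  continuous_iff_continuousAt.2 fun θ =>
    (hasStrictFDerivAt_freqObjective D γ c ν θ).hasFDerivAt.continuousAt

/-- The derivative has the sign of `sigmoid s - sigmoid s₀`. -/
lemma divTerm_lt {γ : ℝ} (hγ : 0 ≤ γ) {w : ℝ} (hw : 0 < w) {s₀ s : ℝ} (h : s ≠ s₀) :
    divTerm γ w (w * sigmoid s₀) s₀ < divTerm γ w (w * sigmoid s₀) s := by
  have hd (s : ℝ) := (hasStrictDerivAt_divTerm (γ := γ) w (w * sigmoid s₀) s).hasDerivAt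
  have hcont : Continuous (divTerm γ w (w * sigmoid s₀)) :=
    continuous_iff_continuousAt.2 fun s => (hd s).continuousAt
  have hg (s : ℝ) : 0 < (γ + 1) * w * scoreFactor γ s := by
    have := scoreFactor_pos γ s; positivity
  have e (s : ℝ) : (γ + 1) * ((w * sigmoid s - w * sigmoid s₀) * scoreFactor γ s) =
      (γ + 1) * w * scoreFactor γ s * (sigmoid s - sigmoid s₀) := by ring
  rcases lt_or_gt_of_ne h with h | h
  · refine strictAntiOn_of_deriv_neg (convex_Iic s₀) hcont.continuousOn (fun x hx => ?_)
      (Set.mem_Iic.2 h.le) Set.self_mem_Iic h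
    rw [interior_Iic] at hx
    rw [(hd x).deriv, e]
    exact mul_neg_of_pos_of_neg (hg x) (sub_neg.2 (Real.sigmoid_lt hx))
  · refine strictMonoOn_of_deriv_pos (convex_Ici s₀) hcont.continuousOn (fun x hx => ?_)
      Set.self_mem_Ici (Set.mem_Ici.2 h.le) h
    rw [interior_Ici] at hx
    rw [(hd x).deriv, e]
    exact mul_pos (hg x) (sub_pos.2 (Real.sigmoid_lt hx))

/-- The limiting objective function. -/
def limitObjective (γ : ℝ) (w : Fin I → ℝ) (θ₀ : Params J) : Params J → ℝ :=
  freqObjective D γ w fun i => w i * failProb D θ₀ i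

lemma limitObjective_lt {γ : ℝ} (hγ : 0 ≤ γ) (hw : ∀ i, 0 ≤ w i) {θ : Params J}
    (h : ∃ i, w i * logit D θ i ≠ w i * logit D θ₀ i) :
    limitObjective D γ w θ₀ θ₀ < limitObjective D γ w θ₀ θ := by
  obtain ⟨i, hi⟩ := h
  simp only [limitObjective, freqObjective, failProb_eq_sigmoid]
  refine Finset.sum_lt_sum (fun j _ => ?_) ⟨i, Finset.mem_univ i, ?_⟩
  · rcases (hw j).eq_or_lt with h | h
    · simp [← h, divTerm]
    · rcases eq_or_ne (logit D θ j) (logit D θ₀ j) with h' | h'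
      · rw [h']
      · exact (divTerm_lt hγ h h').le
  · refine divTerm_lt hγ ((hw i).lt_of_ne' ?_) ?_
    · rintro h; simp [h] at hi
    · rintro h; simp [h] at hi

/-- The weighted log-odds have injective derivative at `θ₀`, so they differ from their value there
at every nearby point. The factor `w i` discards conditions of zero limiting weight. -/
lemma eventually_limitObjective_lt {γ : ℝ} (hγ : 0 ≤ γ) (hw : ∀ i, 0 ≤ w i)
    (hJ : IsUnit (matJ D γ w θ₀).det) :
    ∀ᶠ θ in 𝓝[≠] θ₀, limitObjective D γ w θ₀ θ₀ < limitObjective D γ w θ₀ θ := by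
  have hd : HasFDerivAt (fun θ i => w i * logit D θ i)
      (ContinuousLinearMap.pi fun i => w i • dotCLM (scoreVec D θ₀ i)) θ₀ :=
    hasFDerivAt_pi.2 fun i => (hasStrictFDerivAt_logit D θ₀ i).hasFDerivAt.const_mul (w i)
  have hinj : Function.Injective
      (ContinuousLinearMap.pi fun i => w i • dotCLM (scoreVec D θ₀ i)) := by
    rw [injective_iff_map_eq_zero]
    intro u hu
    refine scoreVec_dotProduct_eq_zero D hJ fun i => ?_
    simpa using congrFun hu i
  obtain ⟨C, -, hC⟩ := LinearMap.exists_antilipschitzWith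
    (ContinuousLinearMap.pi fun i => w i • dotCLM (scoreVec D θ₀ i)).toLinearMap
    (LinearMap.ker_eq_bot.2 hinj)
  filter_upwards [hd.eventually_ne (c := fun i => w i * logit D θ₀ i) ⟨C, hC⟩] with θ hθ
  exact limitObjective_lt D hγ hw (Function.ne_iff.1 hθ)

lemma separated_on_closedBall {γ : ℝ} {ρ : ℝ}
    (hρ : ∀ θ ∈ Metric.closedBall θ₀ ρ, θ ≠ θ₀ →
      limitObjective D γ w θ₀ θ₀ < limitObjective D γ w θ₀ θ) {ε : ℝ} (hε : 0 < ε) :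
    ∃ δ > 0, ∀ θ ∈ Metric.closedBall θ₀ ρ, ε ≤ dist θ θ₀ →
      limitObjective D γ w θ₀ θ₀ + δ ≤ limitObjective D γ w θ₀ θ := by
  have hcomp : IsCompact (Metric.closedBall θ₀ ρ ∩ {θ | ε ≤ dist θ θ₀}) :=
    (isCompact_closedBall θ₀ ρ).inter_right (isClosed_le (by fun_prop) (by fun_prop))
  rcases (Metric.closedBall θ₀ ρ ∩ {θ | ε ≤ dist θ θ₀}).eq_empty_or_nonempty with h | h
  · refine ⟨1, one_pos, fun θ h1 h2 => ?_⟩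
    exact absurd (Set.mem_inter h1 h2) (by rw [h]; simp)
  · obtain ⟨θ₁, ⟨h1, h2⟩, hmin⟩ := hcomp.exists_isMinOn h
      (continuous_freqObjective D γ w _).continuousOn
    have hne : θ₁ ≠ θ₀ := dist_pos.1 (hε.trans_le h2)
    refine ⟨limitObjective D γ w θ₀ θ₁ - limitObjective D γ w θ₀ θ₀,
      sub_pos.2 (hρ θ₁ h1 hne), fun θ h3 h4 => ?_⟩
    rw [add_sub_cancel]
    exact hmin (Set.mem_inter h3 h4)

variable {X : Type*} {l : Filter X} {c ν : X → Fin I → ℝ}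

lemma eventually_mul_le_of_tendsto {f : X → ℝ} {a η : ℝ} (hf : Tendsto f l (𝓝 a)) (ha : 0 ≤ a)
    (hη : 0 < η) (hnn : ∀ᶠ x in l, 0 ≤ f x) : ∀ᶠ x in l, (1 - η) * a ≤ f x := by
  rcases ha.eq_or_lt with rfl | ha
  · simpa using hnn
  · exact (hf.eventually_const_lt (show (1 - η) * a < a by nlinarith)).mono fun x hx => hx.le

lemma tendsto_freqObjective (γ : ℝ) (hc : Tendsto c l (𝓝 w))
    (hν : Tendsto ν l (𝓝 fun i => w i * failProb D θ₀ i)) (θ : Params J) :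
    Tendsto (fun x => freqObjective D γ (c x) (ν x) θ) l (𝓝 (limitObjective D γ w θ₀ θ)) := by
  refine tendsto_finsetSum _ fun i _ => ?_
  have hcont : Continuous fun p : ℝ × ℝ => divTerm γ p.1 p.2 (logit D θ i) := by
    unfold divTerm
    split_ifs <;> fun_prop
  exact (hcont.tendsto (w i, w i * failProb D θ₀ i)).comp
    ((tendsto_pi_nhds.1 hc i).prodMk_nhds (tendsto_pi_nhds.1 hν i))

/-- A lower bound uniform over the noncompact parameter space. For `γ > 0` the powers lie in `[0,
1]` and convergence is uniform. For `γ = 0` the logarithms are unbounded, but all terms are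
nonnegative and the coefficients are eventually at least `1 - η` times their limits. -/
lemma eventually_lt_freqObjective {γ : ℝ} (hγ : 0 ≤ γ) (hw : ∀ i, 0 ≤ w i)
    (hc : Tendsto c l (𝓝 w)) (hν : Tendsto ν l (𝓝 fun i => w i * failProb D θ₀ i))
    (hadm : ∀ᶠ x in l, ∀ i, 0 ≤ ν x i ∧ ν x i ≤ c x i) {a b : ℝ} (hab : a < b) :
    ∀ᶠ x in l, ∀ θ, b ≤ limitObjective D γ w θ₀ θ → a < freqObjective D γ (c x) (ν x) θ := by
  have hci (i : Fin I) := tendsto_pi_nhds.1 hc i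
  have hνi (i : Fin I) := tendsto_pi_nhds.1 hν i
  rcases hγ.eq_or_lt with rfl | hγ
  -- For `a ≥ 0` the choice `η = (b - a) / (2 b)` gives `(1 - η) b = (a + b) / 2`.
  · obtain ⟨η, hη, hη1⟩ : ∃ η, 0 < η ∧ ∀ h, b ≤ h → 0 ≤ h → a < (1 - η) * h := by
      rcases lt_or_ge a 0 with ha | ha
      · refine ⟨1, one_pos, fun h _ _ => by simpa using ha⟩
      · have hb : 0 < b := ha.trans_lt hab
        refine ⟨(b - a) / (2 * b), by have := sub_pos.2 hab; positivity, fun h h1 h2 => ?_⟩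
        have : 1 - (b - a) / (2 * b) = (b + a) / (2 * b) := by field_simp; ring
        rw [this, div_mul_eq_mul_div, lt_div_iff₀ (by positivity)]
        nlinarith
    have h1 : ∀ᶠ x in l, ∀ i, (1 - η) * (w i * failProb D θ₀ i) ≤ ν x i :=
      eventually_all.2 fun i => eventually_mul_le_of_tendsto (hνi i)
        (mul_nonneg (hw i) (failProb_pos D θ₀ i).le) hη (hadm.mono fun x hx => (hx i).1)
    have h2 : ∀ᶠ x in l, ∀ i, (1 - η) * (w i - w i * failProb D θ₀ i) ≤ c x i - ν x i :=
      eventually_all.2 fun i => eventually_mul_le_of_tendsto ((hci i).sub (hνi i))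
        (by have := mul_nonneg (hw i) (relProb_pos D θ₀ i).le
            rw [relProb_eq_one_sub] at this; linarith) hη
        (hadm.mono fun x hx => sub_nonneg.2 (hx i).2)
    have hA (s : ℝ) : 0 ≤ -Real.log (sigmoid s) :=
      neg_nonneg.2 (Real.log_nonpos (Real.sigmoid_nonneg s) (Real.sigmoid_le_one s))
    have hB (s : ℝ) : 0 ≤ -Real.log (1 - sigmoid s) := by
      rw [← Real.sigmoid_neg]; exact hA _
    have hdiv (c ν s : ℝ) : divTerm 0 c ν s =
        ν * -Real.log (sigmoid s) + (c - ν) * -Real.log (1 - sigmoid s) := by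
      simp only [divTerm, if_true]; ring
    filter_upwards [h1, h2] with x hx1 hx2 θ hθ
    have hnn : 0 ≤ limitObjective D 0 w θ₀ θ := by
      unfold limitObjective freqObjective
      refine Finset.sum_nonneg fun i _ => ?_
      rw [hdiv]
      have := mul_nonneg (hw i) (relProb_pos D θ₀ i).le
      rw [relProb_eq_one_sub] at this
      exact add_nonneg (mul_nonneg (mul_nonneg (hw i) (failProb_pos D θ₀ i).le) (hA _))
        (mul_nonneg (by linarith) (hB _))
    refine (hη1 _ hθ hnn).trans_le ?_
    rw [limitObjective, freqObjective, Finset.mul_sum]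
    refine Finset.sum_le_sum fun i _ => ?_
    rw [hdiv, hdiv, mul_add, ← mul_assoc (1 - η) (w i * failProb D θ₀ i),
      ← mul_assoc (1 - η) (w i - w i * failProb D θ₀ i)]
    exact add_le_add (mul_le_mul_of_nonneg_right (hx1 i) (hA _))
      (mul_le_mul_of_nonneg_right (hx2 i) (hB _))
  · set E := fun x => ∑ i, (|w i - c x i| * 2 + (γ + 1) / γ *
      (|w i * failProb D θ₀ i - ν x i| +
        |(w i - w i * failProb D θ₀ i) - (c x i - ν x i)|)) with hE
    have hlim : Tendsto E l (𝓝 0) := by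
      have : (0 : ℝ) = ∑ i : Fin I, (|w i - w i| * 2 + (γ + 1) / γ *
        (|w i * failProb D θ₀ i - w i * failProb D θ₀ i| +
        |(w i - w i * failProb D θ₀ i) - (w i - w i * failProb D θ₀ i)|)) := by simp
      rw [this]
      refine tendsto_finsetSum _ fun i _ => ?_
      exact (((hci i).const_sub (w i)).abs.mul_const 2).add
        ((((hνi i).const_sub _).abs.add (((hci i).sub (hνi i)).const_sub _).abs).const_mul _)
    filter_upwards [hlim.eventually_lt_const (sub_pos.2 hab)] with x hx θ hθ
    have hle : limitObjective D γ w θ₀ θ - freqObjective D γ (c x) (ν x) θ ≤ E x := by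
      rw [limitObjective, freqObjective, freqObjective, ← Finset.sum_sub_distrib]
      refine Finset.sum_le_sum fun i _ => ?_
      set s := logit D θ i
      have hq (p : ℝ) (hp : 0 < p) : 0 ≤ sigmoid s ^ p ∧ sigmoid s ^ p ≤ 1 :=
        ⟨Real.rpow_nonneg (Real.sigmoid_nonneg s) p,
          Real.rpow_le_one (Real.sigmoid_nonneg s) (Real.sigmoid_le_one s) hp.le⟩
      have h1 : 0 ≤ 1 - sigmoid s := sub_nonneg.2 (Real.sigmoid_le_one s)
      have hq' (p : ℝ) (hp : 0 < p) : 0 ≤ (1 - sigmoid s) ^ p ∧ (1 - sigmoid s) ^ p ≤ 1 :=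
        ⟨Real.rpow_nonneg h1 p,
          Real.rpow_le_one h1 (by have := Real.sigmoid_nonneg s; linarith) hp.le⟩
      have hb (a q k : ℝ) (h0 : 0 ≤ q) (h1 : q ≤ k) : a * q ≤ |a| * k :=
        (mul_le_mul_of_nonneg_right (le_abs_self a) h0).trans
          (mul_le_mul_of_nonneg_left h1 (abs_nonneg a))
      have hb' (a q : ℝ) (h0 : 0 ≤ q) (h1 : q ≤ 1) : -(a * q) ≤ |a| := by
        have := hb (-a) q 1 h0 h1
        rw [abs_neg] at this; linarith
      have b1 := hb (w i - c x i) (sigmoid s ^ (γ + 1) + (1 - sigmoid s) ^ (γ + 1)) 2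
        (add_nonneg (hq _ (by linarith)).1 (hq' _ (by linarith)).1)
        (by linarith [(hq (γ + 1) (by linarith)).2, (hq' (γ + 1) (by linarith)).2])
      have b2 := hb' (w i * failProb D θ₀ i - ν x i) (sigmoid s ^ γ) (hq γ hγ).1 (hq γ hγ).2
      have b3 := hb' ((w i - w i * failProb D θ₀ i) - (c x i - ν x i)) ((1 - sigmoid s) ^ γ)
        (hq' γ hγ).1 (hq' γ hγ).2
      have b4 := mul_le_mul_of_nonneg_left (add_le_add b2 b3)
        (show 0 ≤ (γ + 1) / γ by positivity)
      simp only [divTerm, hγ.ne', if_false]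
      refine le_trans (le_of_eq ?_) (add_le_add b1 b4)
      ring
    linarith

/-- Minimizers over a set on which the true parameter is well separated are consistent. -/
lemma eventually_dist_lt_of_isMinOn {γ : ℝ} (hγ : 0 ≤ γ) (hw : ∀ i, 0 ≤ w i)
    (hc : Tendsto c l (𝓝 w)) (hν : Tendsto ν l (𝓝 fun i => w i * failProb D θ₀ i))
    (hadm : ∀ᶠ x in l, ∀ i, 0 ≤ ν x i ∧ ν x i ≤ c x i) {A : Set (Params J)} (hA : θ₀ ∈ A)
    (hsep : ∀ ε > 0, ∃ δ > 0, ∀ θ ∈ A, ε ≤ dist θ θ₀ →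
      limitObjective D γ w θ₀ θ₀ + δ ≤ limitObjective D γ w θ₀ θ) {ε : ℝ} (hε : 0 < ε) :
    ∀ᶠ x in l, ∀ θ ∈ A, IsMinOn (freqObjective D γ (c x) (ν x)) A θ → dist θ θ₀ < ε := by
  obtain ⟨δ, hδ, h⟩ := hsep ε hε
  filter_upwards [eventually_lt_freqObjective D hγ hw hc hν hadm
      (show limitObjective D γ w θ₀ θ₀ + δ / 2 < limitObjective D γ w θ₀ θ₀ + δ by linarith),
    (tendsto_freqObjective D γ hc hν θ₀).eventually_lt_const
      (show limitObjective D γ w θ₀ θ₀ < limitObjective D γ w θ₀ θ₀ + δ / 2 by linarith)]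
    with x h1 h2 θ hθ hmin
  by_contra hcon
  have h3 := h1 θ (h θ hθ (not_lt.1 hcon))
  have h4 : freqObjective D γ (c x) (ν x) θ ≤ freqObjective D γ (c x) (ν x) θ₀ := hmin hA
  linarith

end Argmin

end OneShot
end
noncomputable section

/-! ### Convergence in probability as convergence along a filter. -/

section ProbabilityFilter

open Asymptotics

variable {Ω : Type*} [MeasurableSpace Ω] (P : Measure Ω)

/-- The filter of the sequences of events whose probabilities tend to one. -/
def probFilter : Filter (ℕ × Ω) where
  sets := {s | Tendsto (fun n => P {ω | (n, ω) ∉ s}) atTop (𝓝 0)}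
  univ_sets := by simp
  sets_of_superset {s t} hs hst := by
    refine tendsto_of_tendsto_of_tendsto_of_le_of_le tendsto_const_nhds hs (fun n => zero_le) ?_
    exact fun n => measure_mono fun ω hω h => hω (hst h)
  inter_sets {s t} hs ht := by
    refine tendsto_of_tendsto_of_tendsto_of_le_of_le tendsto_const_nhds
      (by simpa using Tendsto.add hs ht) (fun n => zero_le) fun n => ?_
    refine (measure_mono ?_).trans (measure_union_le _ _)
    intro ω hω
    by_cases h : (n, ω) ∈ s
    · exact Or.inr fun h' => hω ⟨h, h'⟩
    · exact Or.inl h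

variable {P}

lemma eventually_probFilter {p : ℕ × Ω → Prop} :
    (∀ᶠ x in probFilter P, p x) ↔ Tendsto (fun n => P {ω | ¬ p (n, ω)}) atTop (𝓝 0) := Iff.rfl

lemma tendsto_fst_probFilter : Tendsto Prod.fst (probFilter P) atTop := by
  intro s hs
  refine tendsto_const_nhds.congr' ?_
  filter_upwards [hs] with n hn
  simp [hn]

lemma tendstoInMeasure_const_iff {E : Type*} [PseudoMetricSpace E] {f : ℕ → Ω → E} {a : E} :
    TendstoInMeasure P f atTop (fun _ => a) ↔
      Tendsto (fun x : ℕ × Ω => f x.1 x.2) (probFilter P) (𝓝 a) := by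
  rw [tendstoInMeasure_iff_dist, Metric.tendsto_nhds]
  simp only [eventually_probFilter, not_lt]

/-- Portmanteau for the closed complement of a ball about `0`, which the limit law does not charge.
-/
lemma MeasureTheory.TendstoInDistribution.tendsto_probFilter [IsProbabilityMeasure P]
    {E Ω' : Type*} [NormedAddCommGroup E] [MeasurableSpace E] [BorelSpace E]
    [MeasurableSpace Ω'] {μ : Measure Ω'} [IsProbabilityMeasure μ] {X : ℕ → Ω → E}
    (h : TendstoInDistribution X atTop (fun _ => 0) (fun _ => P) μ) :
    Tendsto (fun x : ℕ × Ω => X x.1 x.2) (probFilter P) (𝓝 0) := by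
  rw [Metric.tendsto_nhds]
  intro ε hε
  rw [eventually_probFilter]
  have hcl : IsClosed {x : E | ε ≤ dist x 0} := isClosed_le continuous_const (by fun_prop)
  have h1 := ProbabilityMeasure.limsup_measure_closed_le_of_tendsto h.tendsto hcl
  have h2 : (μ.map fun _ => (0 : E)) {x : E | ε ≤ dist x 0} = 0 := by
    rw [Measure.map_apply measurable_const hcl.measurableSet]
    simp [not_le.2 hε]
  simp only [ProbabilityMeasure.coe_mk] at h1
  rw [h2] at h1
  have h3 (n : ℕ) : P {ω | ¬ dist (X n ω) 0 < ε} = (P.map (X n)) {x : E | ε ≤ dist x 0} := by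
    rw [Measure.map_apply_of_aemeasurable (h.forall_aemeasurable n) hcl.measurableSet]
    simp only [not_lt]; rfl
  simp_rw [h3]
  exact tendsto_of_le_liminf_of_limsup_le zero_le h1

/-- If `R n` differs from `q (X n)`, with `q` continuous, by a remainder that is negligible
compared with `‖X n‖ ^ 2`, then it has the same limit in distribution. -/
lemma MeasureTheory.TendstoInDistribution.of_sub_isLittleO [IsProbabilityMeasure P]
    {E Ω' : Type*} [NormedAddCommGroup E] [MeasurableSpace E] [BorelSpace E]
    [SecondCountableTopology E]
    [MeasurableSpace Ω'] {μ : Measure Ω'} [IsProbabilityMeasure μ] {X : ℕ → Ω → E} {Z : Ω' → E}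
    (hX : TendstoInDistribution X atTop Z (fun _ => P) μ) {q : E → ℝ} (hq : Continuous q)
    {R : ℕ → Ω → ℝ} (hR : ∀ n, AEMeasurable (R n) P)
    (h : (fun x : ℕ × Ω => R x.1 x.2 - q (X x.1 x.2)) =o[probFilter P]
      fun x => ‖X x.1 x.2‖ * ‖X x.1 x.2‖) :
    TendstoInDistribution R atTop (fun ω => q (Z ω)) (fun _ => P) μ := by
  have hmX := hX.forall_aemeasurable
  have hmq (n : ℕ) : AEMeasurable (fun ω => q (X n ω)) P :=
    hq.measurable.comp_aemeasurable (hmX n)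
  set e : ℕ → Ω → ℝ := fun n ω => (R n ω - q (X n ω)) / (‖X n ω‖ * ‖X n ω‖)
  have he : TendstoInMeasure P e atTop fun _ => 0 :=
    tendstoInMeasure_const_iff.2 h.tendsto_div_nhds_zero
  have hme (n : ℕ) : AEMeasurable (e n) P := by
    have := (hmX n).norm
    have h1 := hR n
    have h2 := hmq n
    fun_prop
  -- Slutsky: the relative remainder `e` tends to `0` in probability, so `q (X n) + e n * ‖X n‖ ^ 2`
  -- has the limit law of `q (X n)`.
  have hW := hX.continuous_comp_prodMk_of_tendstoInMeasure_const
    (g := fun p : E × ℝ => q p.1 + p.2 * (‖p.1‖ * ‖p.1‖)) (by fun_prop) he hme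
  simp only [zero_mul, add_zero] at hW
  refine tendstoInDistribution_of_tendstoInMeasure_sub R _ hW ?_ hR
  refine tendstoInMeasure_const_iff.2 (tendsto_const_nhds.congr' ?_)
  filter_upwards [h.bound one_pos] with x hx
  change (0 : ℝ) = R x.1 x.2 - (q (X x.1 x.2) +
    (R x.1 x.2 - q (X x.1 x.2)) / (‖X x.1 x.2‖ * ‖X x.1 x.2‖) * (‖X x.1 x.2‖ * ‖X x.1 x.2‖))
  -- Where `X` vanishes the quotient is `0` by convention, and the little-o bound forces `R = q
  -- (X)`.
  rcases eq_or_ne ‖X x.1 x.2‖ 0 with h0 | h0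
  · rw [h0] at hx ⊢
    simp only [mul_zero, norm_zero, norm_le_zero_iff] at hx
    rw [mul_zero, mul_zero, add_zero, hx]
  · field_simp
    ring

end ProbabilityFilter

/-! ### Quadratic forms in normal vectors. -/

section Gaussian

open Matrix

variable {ι κ : Type*} [Fintype ι] [Fintype κ]

/-- The standard normal distribution on `ι → ℝ`. -/
abbrev stdNormal (ι : Type*) [Fintype ι] : Measure (ι → ℝ) :=
  Measure.pi fun _ : ι => gaussianReal 0 1

lemma measurable_toLp_mulVec (A : Matrix κ ι ℝ) :
    Measurable fun ξ : ι → ℝ => WithLp.toLp 2 (A *ᵥ ξ) :=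
  ((PiLp.continuous_toLp 2 _).comp (continuous_const.matrix_mulVec continuous_id)).measurable

/-- `A` enters only through `A * Aᵀ`: this identifies normal laws by covariance and gives the limit
in the central limit theorem. -/
lemma charFun_map_mulVec_stdNormal (A : Matrix κ ι ℝ) (t : EuclideanSpace ℝ κ) :
    charFun ((stdNormal ι).map fun ξ => WithLp.toLp 2 (A *ᵥ ξ)) t =
      Complex.exp (-((t.ofLp ⬝ᵥ (A * Aᵀ) *ᵥ t.ofLp : ℝ) : ℂ) / 2) := by
  have h : charFun ((stdNormal ι).map fun ξ => WithLp.toLp 2 (A *ᵥ ξ)) t =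
      charFun ((stdNormal ι).map (WithLp.toLp 2)) (WithLp.toLp 2 (Aᵀ *ᵥ t.ofLp)) := by
    rw [charFun_apply, charFun_apply, integral_map (measurable_toLp_mulVec A).aemeasurable
      (Measurable.aestronglyMeasurable (by fun_prop)),
      integral_map (Measurable.aemeasurable (by fun_prop))
      (Measurable.aestronglyMeasurable (by fun_prop))]
    refine integral_congr_ae (Eventually.of_forall fun ξ => ?_)
    simp only [EuclideanSpace.inner_eq_star_dotProduct, star_trivial]
    rw [dotProduct_mulVec, mulVec_transpose]
  rw [h, charFun_pi]
  simp_rw [charFun_gaussianReal]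
  rw [← Complex.exp_sum]
  congr 1
  have e : t.ofLp ⬝ᵥ (A * Aᵀ) *ᵥ t.ofLp = ∑ i, (Aᵀ *ᵥ t.ofLp) i ^ 2 := by
    rw [← mulVec_mulVec, dotProduct_mulVec, ← mulVec_transpose]
    simp [dotProduct, sq]
  rw [e]
  push_cast
  rw [neg_div, Finset.sum_div, ← Finset.sum_neg_distrib]
  refine Finset.sum_congr rfl fun i _ => ?_
  simp

open scoped MatrixOrder in
lemma Matrix.PosDef.exists_whitening {B : Matrix κ κ ℝ} [DecidableEq κ] (hB : B.PosDef) :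
    ∃ S : Matrix κ κ ℝ, B⁻¹ = Sᵀ * S ∧ S * B * Sᵀ = 1 := by
  obtain ⟨S, hS⟩ := CStarAlgebra.nonneg_iff_eq_star_mul_self.1 hB.inv.posSemidef.nonneg
  rw [star_eq_conjTranspose, conjTranspose_eq_transpose_of_trivial] at hS
  refine ⟨S, hS, ?_⟩
  have hdet : IsUnit B.det := (isUnit_iff_isUnit_det _).1 hB.isUnit
  have h1 : Sᵀ * (S * B) = 1 := by rw [← Matrix.mul_assoc, ← hS, nonsing_inv_mul _ hdet]
  exact mul_eq_one_comm.1 h1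

/-- The law of `Wᵀ B⁻¹ W`, where `W` is centred normal with covariance matrix `B`. -/
lemma map_quadraticForm_stdNormal {r : ℕ} (A : Matrix (Fin r) ι ℝ) {B : Matrix (Fin r) (Fin r) ℝ}
    (hB : B.PosDef) (hAB : A * Aᵀ = B) :
    (stdNormal ι).map (fun ξ => (A *ᵥ ξ) ⬝ᵥ (B⁻¹ *ᵥ (A *ᵥ ξ))) = OneShot.chiSquared r := by
  obtain ⟨S, hS, hS1⟩ := hB.exists_whitening
  -- After whitening, the covariance `S B Sᵀ` is the identity.
  have hC : (stdNormal ι).map (fun ξ => WithLp.toLp 2 ((S * A) *ᵥ ξ)) =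
      (stdNormal (Fin r)).map fun ξ => WithLp.toLp 2 ((1 : Matrix (Fin r) (Fin r) ℝ) *ᵥ ξ) := by
    have := Measure.isProbabilityMeasure_map (μ := stdNormal ι)
      (measurable_toLp_mulVec (S * A)).aemeasurable
    have := Measure.isProbabilityMeasure_map (μ := stdNormal (Fin r))
      (measurable_toLp_mulVec (1 : Matrix (Fin r) (Fin r) ℝ)).aemeasurable
    refine Measure.ext_of_charFun (funext fun t => ?_)
    rw [charFun_map_mulVec_stdNormal, charFun_map_mulVec_stdNormal]
    have : S * A * (S * A)ᵀ = 1 * 1ᵀ := by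
      rw [transpose_mul, Matrix.mul_assoc, ← Matrix.mul_assoc A, hAB, ← Matrix.mul_assoc, hS1]
      simp
    rw [this]
  have hsq : Measurable fun x : EuclideanSpace ℝ (Fin r) => ∑ s, x s ^ 2 := by fun_prop
  have h := congrArg (Measure.map fun x : EuclideanSpace ℝ (Fin r) => ∑ s, x s ^ 2) hC
  rw [Measure.map_map hsq (measurable_toLp_mulVec _),
    Measure.map_map hsq (measurable_toLp_mulVec _)] at h
  have e1 : (fun ξ => (A *ᵥ ξ) ⬝ᵥ (B⁻¹ *ᵥ (A *ᵥ ξ))) =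
      (fun x : EuclideanSpace ℝ (Fin r) => ∑ s, x s ^ 2) ∘
        fun ξ => WithLp.toLp 2 ((S * A) *ᵥ ξ) := by
    ext ξ
    rw [hS, ← mulVec_mulVec, dotProduct_mulVec _ Sᵀ, vecMul_transpose]
    simp [dotProduct, sq]
  have e2 : (fun x : EuclideanSpace ℝ (Fin r) => ∑ s, x s ^ 2) ∘
      (fun ξ => WithLp.toLp 2 ((1 : Matrix (Fin r) (Fin r) ℝ) *ᵥ ξ)) =
      fun z => ∑ s, z s ^ 2 := by
    ext ξ; simp
  rw [e1, h, e2]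
  rfl

lemma MeasureTheory.TendstoInDistribution.congr_limit {Ω E Ω₁ Ω₂ : Type*} [MeasurableSpace Ω]
    {P : Measure Ω} [IsProbabilityMeasure P] [MeasurableSpace Ω₁] {μ₁ : Measure Ω₁}
    [IsProbabilityMeasure μ₁] [MeasurableSpace Ω₂] {μ₂ : Measure Ω₂} [IsProbabilityMeasure μ₂]
    [TopologicalSpace E] [MeasurableSpace E] [OpensMeasurableSpace E] {X : ℕ → Ω → E}
    {Z : Ω₁ → E} {W : Ω₂ → E} (h : TendstoInDistribution X atTop Z (fun _ => P) μ₁)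
    (hW : AEMeasurable W μ₂) (hZW : μ₁.map Z = μ₂.map W) :
    TendstoInDistribution X atTop W (fun _ => P) μ₂ where
  forall_aemeasurable := h.forall_aemeasurable
  aemeasurable_limit := hW
  tendsto := by
    convert! h.tendsto using 2
    exact congrArg 𝓝 (Subtype.ext hZW.symm)

end Gaussian

/-! ### Powers of the centred Bernoulli characteristic function. -/

section Bernoulli

open Asymptotics

/-- The exponents need not tend to infinity, so conditions with few devices and zero limiting weight
are covered. -/
lemma tendsto_one_add_pow_exp {z : ℕ → ℂ} {k : ℕ → ℕ} {a : ℂ} (hz : Tendsto z atTop (𝓝 0))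
    (hk : Tendsto (fun n => (k n : ℂ) * z n) atTop (𝓝 a)) :
    Tendsto (fun n => (1 + z n) ^ k n) atTop (𝓝 (Complex.exp a)) := by
  have hd : HasDerivAt (fun z : ℂ => Complex.log (1 + z)) 1 0 := by
    have := ((hasDerivAt_id (0 : ℂ)).const_add 1).clog (by simp)
    simpa using this
  have ho : (fun n => Complex.log (1 + z n) - z n) =o[atTop] z := by
    have := hd.isLittleO.comp_tendsto hz
    simpa [Function.comp_def] using this
  have h1 : Tendsto (fun n => (k n : ℂ) * (Complex.log (1 + z n) - z n)) atTop (𝓝 0) := by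
    rw [← isLittleO_one_iff ℂ]
    exact ((isBigO_refl _ _).mul_isLittleO ho).trans_isBigO (hk.isBigO_one ℂ)
  have h2 := (hk.add h1).cexp
  rw [add_zero] at h2
  refine h2.congr' ?_
  have hne : ∀ᶠ n in atTop, z n ≠ -1 := hz.eventually_ne (by simp)
  filter_upwards [hne] with n hn
  have h0 : 1 + z n ≠ 0 := fun h => hn (eq_neg_of_add_eq_zero_right h)
  rw [← mul_add, add_sub_cancel, Complex.exp_nat_mul, Complex.exp_log h0]

/-- The characteristic function of a centred Bernoulli variable. -/
def bernoulliCharFun (p s : ℝ) : ℂ :=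
  p * Complex.exp ((s * (1 - p) : ℝ) * Complex.I) +
    (1 - p) * Complex.exp ((s * (0 - p) : ℝ) * Complex.I)

/-- Centring cancels the linear terms; the quadratic ones add up to the variance `p (1 - p)`. -/
lemma bernoulliCharFun_isLittleO (p : ℝ) :
    (fun s : ℝ => bernoulliCharFun p s - 1 + (p * (1 - p) / 2 : ℝ) * (s : ℂ) ^ 2) =o[𝓝 0]
      fun s => (s : ℂ) ^ 2 := by
  have hexp (q : ℝ) : (fun s : ℝ => Complex.exp ((s * q : ℝ) * Complex.I) -
      (1 + s * q * Complex.I - (s * q) ^ 2 / 2)) =o[𝓝 0] fun s : ℝ => (s : ℂ) ^ 2 := by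
    have ht : Tendsto (fun s : ℝ => ((s * q : ℝ) * Complex.I : ℂ)) (𝓝 0) (𝓝 0) := by
      have : Continuous fun s : ℝ => ((s * q : ℝ) * Complex.I : ℂ) := by fun_prop
      simpa using this.tendsto 0
    have h := (Complex.exp_sub_sum_range_succ_isLittleO_pow 2).comp_tendsto ht
    have h2 : (fun s : ℝ => ((s * q : ℝ) * Complex.I : ℂ) ^ 2) =O[𝓝 0] fun s => (s : ℂ) ^ 2 := by
      refine (isBigO_const_mul_self (-(q : ℂ) ^ 2) _ _).congr_left fun s => ?_
      rw [mul_pow, Complex.I_sq]; push_cast; ring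
    refine (h.trans_isBigO h2).congr_left fun s => ?_
    simp only [Function.comp_apply, Finset.sum_range_succ, Finset.sum_range_zero]
    simp only [mul_pow, Complex.I_sq]
    push_cast [Nat.factorial]
    ring
  refine (((hexp (1 - p)).const_mul_left p).add ((hexp (0 - p)).const_mul_left (1 - p))).congr_left
    fun s => ?_
  rw [bernoulliCharFun]
  push_cast
  ring

lemma tendsto_bernoulliCharFun_pow {p t w : ℝ} {k : ℕ → ℕ} {s : ℕ → ℝ}
    (hs : Tendsto s atTop (𝓝 0)) (hk : Tendsto (fun n => k n * s n ^ 2) atTop (𝓝 (w * t ^ 2))) :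
    Tendsto (fun n => bernoulliCharFun p (s n) ^ k n) atTop
      (𝓝 (Complex.exp (-((w * (p * (1 - p)) * t ^ 2 : ℝ) : ℂ) / 2))) := by
  have ho := (bernoulliCharFun_isLittleO p).comp_tendsto hs
  have hkc : Tendsto (fun n => (k n : ℂ) * (s n : ℂ) ^ 2) atTop (𝓝 ((w * t ^ 2 : ℝ) : ℂ)) := by
    have := (Complex.continuous_ofReal.tendsto _).comp hk
    refine this.congr fun n => ?_
    simp
  have hz : Tendsto (fun n => bernoulliCharFun p (s n) - 1) atTop (𝓝 0) := by
    have : Continuous fun s => bernoulliCharFun p s - 1 := by unfold bernoulliCharFun; fun_prop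
    have h := (this.tendsto 0).comp hs
    simpa [bernoulliCharFun, Function.comp_def] using h
  have h := tendsto_one_add_pow_exp (k := k)
    (a := -((w * (p * (1 - p)) * t ^ 2 : ℝ) : ℂ) / 2) hz ?_
  · simpa using h
  have h1 : Tendsto (fun n => (k n : ℂ) * (bernoulliCharFun p (s n) - 1 +
      (p * (1 - p) / 2 : ℝ) * (s n : ℂ) ^ 2)) atTop (𝓝 0) := by
    rw [← isLittleO_one_iff ℂ]
    exact ((isBigO_refl _ _).mul_isLittleO ho).trans_isBigO (hkc.isBigO_one ℂ)
  have h2 := h1.sub (hkc.const_mul ((p * (1 - p) / 2 : ℝ) : ℂ))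
  have e : -((w * (p * (1 - p)) * t ^ 2 : ℝ) : ℂ) / 2 =
      0 - ((p * (1 - p) / 2 : ℝ) : ℂ) * ((w * t ^ 2 : ℝ) : ℂ) := by push_cast; ring
  rw [e]
  refine h2.congr fun n => ?_
  ring

end Bernoulli

/-! ### Distribution function of the log-logistic law. -/

namespace OneShot

lemma logLogistic_Iic {α β τ : ℝ} (hα : 0 < α) (hβ : 0 < β) (hτ : 0 < τ) :
    logLogistic α β (Set.Iic τ) = ENNReal.ofReal (τ ^ β / (τ ^ β + α ^ β)) := by
  set G : ℝ → ℝ := fun t => t ^ β / (t ^ β + α ^ β)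
  have hαβ := Real.rpow_pos_of_pos hα β
  have hpos (t : ℝ) (ht : 0 ≤ t) : 0 < t ^ β + α ^ β :=
    add_pos_of_nonneg_of_pos (Real.rpow_nonneg ht β) hαβ
  have hcont : ContinuousOn G (Set.Icc 0 τ) := by
    have : ContinuousOn (fun t : ℝ => t ^ β) (Set.Icc 0 τ) :=
      (Real.continuous_rpow_const hβ.le).continuousOn
    exact this.div (this.add continuousOn_const) fun t ht => (hpos t ht.1).ne'
  have hderiv : ∀ t ∈ Set.Ioo 0 τ, HasDerivAt G (logLogisticPDF α β t) t := by
    intro t ht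
    have h1 := Real.hasDerivAt_rpow_const (p := β) (Or.inl ht.1.ne')
    have h2 := h1.div (h1.add_const (α ^ β)) (hpos t ht.1.le).ne'
    convert! h2 using 1
    rw [logLogisticPDF, if_pos ht.1]
    congr 1; ring
  have hnn (t : ℝ) : 0 ≤ logLogisticPDF α β t := by
    rw [logLogisticPDF]
    split_ifs with ht
    · have := Real.rpow_nonneg ht.le (β - 1)
      positivity
    · exact le_rfl
  -- The density is unbounded at `0` when `β < 1`; integrability comes from its being the
  -- nonnegative derivative of the continuous `G`.
  have hint := intervalIntegral.integrableOn_deriv_of_nonneg hcont hderiv fun t _ => hnn t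
  have hval := intervalIntegral.integral_eq_sub_of_hasDerivAt_of_le hτ.le hcont hderiv
    ((intervalIntegrable_iff_integrableOn_Ioc_of_le hτ.le).2 hint)
  have hG0 : G 0 = 0 := by simp [G, Real.zero_rpow hβ.ne']
  rw [hG0, sub_zero, intervalIntegral.integral_of_le hτ.le] at hval
  change _ = G τ at hval
  change _ = ENNReal.ofReal (G τ)
  rw [logLogistic, withDensity_apply _ measurableSet_Iic, ← hval,
    ofReal_integral_eq_lintegral_ofReal hint (Eventually.of_forall hnn),
    ← Set.Iic_union_Ioc_eq_Iic hτ.le, lintegral_union measurableSet_Ioc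
      (Set.Iic_disjoint_Ioc le_rfl)]
  have h0 : ∫⁻ t in Set.Iic (0 : ℝ), ENNReal.ofReal (logLogisticPDF α β t) = 0 := by
    rw [setLIntegral_congr_fun (g := fun _ => 0) measurableSet_Iic]
    · simp
    · intro t ht
      simp [logLogisticPDF, not_lt.2 (Set.mem_Iic.1 ht)]
  rw [h0, zero_add]

end OneShot
end
noncomputable section

/-! ### Measurability of matrix expressions and of the statistic. -/

section MeasurableMatrix

open Matrix

variable {X m n p : Type*} [MeasurableSpace X]

/-- Measurability of all entries of a matrix-valued function. -/
def MeasurableEntries (A : X → Matrix m n ℝ) : Prop := ∀ i j, Measurable fun x => A x i j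

namespace MeasurableEntries

lemma transpose {A : X → Matrix m n ℝ} (hA : MeasurableEntries A) :
    MeasurableEntries fun x => (A x)ᵀ := fun i j => hA j i

lemma mul [Fintype n] {A : X → Matrix m n ℝ} {B : X → Matrix n p ℝ}
    (hA : MeasurableEntries A) (hB : MeasurableEntries B) :
    MeasurableEntries fun x => A x * B x := fun i j => by
  simp only [mul_apply]
  exact Finset.measurable_fun_sum _ fun k _ => (hA i k).mul (hB k j)

lemma mulVec [Fintype n] {A : X → Matrix m n ℝ} {v : X → n → ℝ}
    (hA : MeasurableEntries A) (hv : Measurable v) : Measurable fun x => A x *ᵥ v x := by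
  refine measurable_pi_lambda _ fun i => ?_
  simp only [Matrix.mulVec, dotProduct]
  exact Finset.measurable_fun_sum _ fun k _ => (hA i k).mul ((measurable_pi_apply k).comp hv)

lemma det [Fintype n] [DecidableEq n] {A : X → Matrix n n ℝ} (hA : MeasurableEntries A) :
    Measurable fun x => (A x).det := by
  simp only [det_apply]
  exact Finset.measurable_fun_sum _ fun σ _ =>
    (Finset.measurable_fun_prod _ fun i _ => hA (σ i) i).const_smul _

lemma inv [Fintype n] [DecidableEq n] {A : X → Matrix n n ℝ} (hA : MeasurableEntries A) :
    MeasurableEntries fun x => (A x)⁻¹ := fun i j => by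
  simp only [inv_def, Ring.inverse_eq_inv', Matrix.smul_apply, adjugate_apply, smul_eq_mul]
  refine hA.det.inv.mul (det fun k l => ?_)
  simp only [updateRow_apply]
  split_ifs
  · exact measurable_const
  · exact hA k l

end MeasurableEntries

end MeasurableMatrix

namespace OneShot

open Matrix

variable {I J r : ℕ} (D : Design I J)

/-- `m` is arbitrary away from `θ₀`: `fderiv` and the matrix inverse are measurable everywhere,
including where they take default values. -/
lemma measurable_raoQuad (m : Params J → Fin r → ℝ) (γ : ℝ) (c : Fin I → ℝ) :
    Measurable fun p : (Fin I → ℝ) × Params J => raoQuad D m γ c p.1 p.2 := by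
  have hM : MeasurableEntries fun p : (Fin I → ℝ) × Params J => matM m p.2 := fun i s => by
    have h : Measurable fun θ => fderiv ℝ m θ (Pi.single i 1) :=
      measurable_fderiv_apply_const ℝ m _
    exact (measurable_pi_apply s).comp (h.comp measurable_snd)
  have hJ : MeasurableEntries fun p : (Fin I → ℝ) × Params J => matJ D γ c p.2 := fun i j => by
    have h := (continuous_matJ D γ).comp
      ((continuous_const (y := c)).prodMk (continuous_snd (X := Fin I → ℝ) (Y := Params J)))
    exact (h.matrix_elem i j).measurable
  have hK : MeasurableEntries fun p : (Fin I → ℝ) × Params J => matK D γ c p.2 := fun i j => by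
    have h := (continuous_matK D γ).comp
      ((continuous_const (y := c)).prodMk (continuous_snd (X := Fin I → ℝ) (Y := Params J)))
    exact (h.matrix_elem i j).measurable
  have hQ : MeasurableEntries fun p : (Fin I → ℝ) × Params J => matQ D m γ c p.2 :=
    (hJ.inv.mul hM).mul ((hM.transpose.mul hJ.inv).mul hM).inv
  have hB : MeasurableEntries fun p : (Fin I → ℝ) × Params J => matB D m γ c p.2 :=
    (hQ.transpose.mul hK).mul hQ
  have hU : Measurable fun p : (Fin I → ℝ) × Params J => meanScore D γ p.2 c p.1 := by
    unfold meanScore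
    refine Finset.measurable_fun_sum _ fun i _ => ?_
    have h1 : Measurable fun p : (Fin I → ℝ) × Params J => failProb D p.2 i :=
      (contDiff_failProb D i).continuous.measurable.comp measurable_snd
    have h2 : Measurable fun p : (Fin I → ℝ) × Params J => scoreTerm D γ p.2 i :=
      (contDiff_scoreTerm D γ i).continuous.measurable.comp measurable_snd
    exact ((h1.const_mul _).sub ((measurable_pi_apply i).comp measurable_fst)).smul h2
  have hV := hQ.transpose.mulVec hU
  have hW := hB.inv.mulVec hV
  simp only [raoQuad, dotProduct]
  exact Finset.measurable_fun_sum _ fun s _ =>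
    ((measurable_pi_apply s).comp hV).mul ((measurable_pi_apply s).comp hW)

lemma measurable_indicator_Iic (τ : ℝ) : Measurable fun x : ℝ => if x ≤ τ then (1 : ℝ) else 0 :=
  Measurable.ite measurableSet_Iic measurable_const measurable_const

lemma measurable_single_indicator (i : Fin I) (a τ p : ℝ) : Measurable fun x : ℝ =>
    EuclideanSpace.single i (a * ((if x ≤ τ then (1 : ℝ) else 0) - p)) := by
  have h : Continuous fun y : ℝ => EuclideanSpace.single i y :=
    (PiLp.continuous_toLp 2 _).comp (continuous_single (A := fun _ => ℝ) i)
  exact h.measurable.comp (((measurable_indicator_Iic τ).sub_const p).const_mul a)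

lemma total_nonneg (K : Fin I → ℕ) : 0 ≤ total K := Finset.sum_nonneg fun _ _ => by positivity

lemma weights_nonneg (K : Fin I → ℕ) (i : Fin I) : 0 ≤ weights K i :=
  div_nonneg (by positivity) (total_nonneg K)

/-- Standard deviations of the limits of the scaled residuals. -/
def limitSD (w : Fin I → ℝ) (θ₀ : Params J) (i : Fin I) : ℝ :=
  √(w i * (failProb D θ₀ i * relProb D θ₀ i))

lemma limitSD_sq {w : Fin I → ℝ} {θ₀ : Params J} (hw : ∀ i, 0 ≤ w i) (i : Fin I) :
    limitSD D w θ₀ i * limitSD D w θ₀ i = w i * (failProb D θ₀ i * relProb D θ₀ i) :=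
  Real.mul_self_sqrt (mul_nonneg (hw i)
    (mul_nonneg (failProb_pos D θ₀ i).le (relProb_pos D θ₀ i).le))

/-! ### Counts as sums over devices; central limit theorem for the residuals. -/

section Counts

variable {Ω : Type*} {θ₀ : Params J} {K : ℕ → Fin I → ℕ}
    {T : (n : ℕ) → (i : Fin I) → Fin (K n i) → Ω → ℝ} {N : ℕ → Ω → Fin I → ℕ}
    (hN : ∀ n ω, N n ω = failures D (fun i k => T n i k ω))
include hN

lemma failures_eq_sum (n : ℕ) (ω : Ω) (i : Fin I) :
    (N n ω i : ℝ) = ∑ k : Fin (K n i), if T n i k ω ≤ D.τ i then 1 else 0 := by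
  rw [hN, failures, Finset.card_filter]
  push_cast
  rfl

lemma failures_le (n : ℕ) (ω : Ω) (i : Fin I) : N n ω i ≤ K n i := by
  rw [hN, failures]
  exact (Finset.card_filter_le _ _).trans (by simp)

/-- Each device contributes a vector along the axis of its condition. The Euclidean norm is used
because characteristic functions require an inner product. -/
lemma sqrt_smul_residual (n : ℕ) (ω : Ω) :
    WithLp.toLp 2 (√(total (K n)) • residual D θ₀ (weights (K n)) (failFreq (K n) (N n ω))) =
      ∑ p : (Σ i : Fin I, Fin (K n i)), EuclideanSpace.single p.1
        ((√(total (K n)))⁻¹ *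
          ((if T n p.1 p.2 ω ≤ D.τ p.1 then (1 : ℝ) else 0) - failProb D θ₀ p.1)) := by
  ext i
  rw [Fintype.sum_sigma, WithLp.ofLp_sum, Finset.sum_apply, Finset.sum_eq_single i]
  · rw [WithLp.ofLp_sum, Finset.sum_apply]
    simp only [PiLp.single_apply, if_true]
    rw [← Finset.mul_sum, Finset.sum_sub_distrib, ← failures_eq_sum D hN]
    simp only [Pi.smul_apply, residual, weights, failFreq, smul_eq_mul, Finset.sum_const,
      Finset.card_univ, Fintype.card_fin, nsmul_eq_mul]
    have h := Real.sqrt_div_self' (x := total (K n))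
    rw [one_div] at h
    rw [← h]
    ring
  · intro j _ hj
    rw [WithLp.ofLp_sum, Finset.sum_apply]
    exact Finset.sum_eq_zero fun k _ => by simp [hj.symm]
  · simp

end Counts

section Sample

variable {Ω : Type*} [MeasurableSpace Ω] {P : Measure Ω} [IsProbabilityMeasure P]

lemma charFun_map_single_indicator {T : Ω → ℝ} (hT : AEMeasurable T P) {τ p : ℝ} (hp0 : 0 ≤ p)
    (hp : P {ω | T ω ≤ τ} = ENNReal.ofReal p) (i : Fin I) (a : ℝ)
    (t : EuclideanSpace ℝ (Fin I)) :
    charFun (P.map fun ω => EuclideanSpace.single i (a * ((if T ω ≤ τ then 1 else 0) - p))) t =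
      bernoulliCharFun p (a * t i) := by
  have hS : NullMeasurableSet {ω | T ω ≤ τ} P := nullMeasurableSet_le hT aemeasurable_const
  have hmeas : AEMeasurable
      (fun ω => EuclideanSpace.single i (a * ((if T ω ≤ τ then (1 : ℝ) else 0) - p))) P := by
    exact (measurable_single_indicator i a τ p).comp_aemeasurable hT
  rw [charFun_apply, integral_map hmeas (Measurable.aestronglyMeasurable (by fun_prop))]
  set A : ℂ := Complex.exp ((a * t i * (1 - p) : ℝ) * Complex.I)
  set B : ℂ := Complex.exp ((a * t i * (0 - p) : ℝ) * Complex.I)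
  have e : (fun ω => Complex.exp (((inner ℝ (EuclideanSpace.single i
      (a * ((if T ω ≤ τ then (1 : ℝ) else 0) - p))) t : ℝ) : ℂ) * Complex.I)) =
      fun ω => B + {ω | T ω ≤ τ}.indicator (fun _ => A - B) ω := by
    ext ω
    rw [EuclideanSpace.inner_single_left]
    by_cases h : T ω ≤ τ
    · simp only [h, if_true, Set.indicator, Set.mem_ofPred_eq, add_sub_cancel, A]
      congr 2; simp; ring
    · simp only [h, if_false, Set.indicator, Set.mem_ofPred_eq, add_zero, B]
      congr 2; simp; ring
  rw [e, integral_add (integrable_const _) ((integrable_const _).indicator₀ hS), integral_const,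
    integral_indicator₀ hS, setIntegral_const, measureReal_def (s := {ω | T ω ≤ τ}), hp, ENNReal.toReal_ofReal hp0]
  simp only [probReal_univ, one_smul, Complex.real_smul, bernoulliCharFun, A, B]
  ring

variable {θ₀ : Params J} {K : ℕ → Fin I → ℕ} {w : Fin I → ℝ}
    {T : (n : ℕ) → (i : Fin I) → Fin (K n i) → Ω → ℝ}
    (hlaw : ∀ n i k, HasLaw (T n i k) (logLogistic (scale D θ₀ i) (shape D θ₀ i)) P)
    (hindep : ∀ n, iIndepFun (fun p : (Σ i : Fin I, Fin (K n i)) => T n p.1 p.2) P)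
    {N : ℕ → Ω → Fin I → ℕ}
    (hN : ∀ n ω, N n ω = failures D (fun i k => T n i k ω))

include hlaw hN in
omit [IsProbabilityMeasure P] in
lemma aemeasurable_failFreq (n : ℕ) :
    AEMeasurable (fun ω => failFreq (K n) (N n ω)) P := by
  refine aemeasurable_pi_lambda _ fun i => ?_
  simp only [failFreq, failures_eq_sum D hN]
  refine AEMeasurable.div_const (Finset.aemeasurable_fun_sum _ fun k _ => ?_) _
  exact (measurable_indicator_Iic _).comp_aemeasurable (hlaw n i k).aemeasurable

include hlaw hindep hN

lemma charFun_sqrt_smul_residual (n : ℕ) (t : EuclideanSpace ℝ (Fin I)) :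
    charFun (P.map fun ω => WithLp.toLp 2
      (√(total (K n)) • residual D θ₀ (weights (K n)) (failFreq (K n) (N n ω)))) t =
      ∏ i, bernoulliCharFun (failProb D θ₀ i) ((√(total (K n)))⁻¹ * t i) ^ K n i := by
  simp_rw [sqrt_smul_residual D hN]
  have hg (p : Σ i : Fin I, Fin (K n i)) : Measurable fun x : ℝ =>
      EuclideanSpace.single p.1 ((√(total (K n)))⁻¹ *
          ((if x ≤ D.τ p.1 then (1 : ℝ) else 0) - failProb D θ₀ p.1)) :=
    measurable_single_indicator _ _ _ _
  have hi := (hindep n).comp _ hg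
  have h := hi.charFun_map_fun_sum_eq_prod fun p =>
    (hg p).comp_aemeasurable (hlaw n p.1 p.2).aemeasurable
  simp only [Function.comp_def] at h
  rw [h, Finset.prod_apply, Fintype.prod_sigma]
  refine Finset.prod_congr rfl fun i _ => ?_
  rw [Finset.prod_congr rfl fun k _ => charFun_map_single_indicator
    (hlaw n i k).aemeasurable (failProb_pos D θ₀ i).le ?_ i _ t]
  · simp
  · rw [(hlaw n i _).measure_eq measurableSet_Iic]
    exact logLogistic_Iic (scale_pos D θ₀ i) (shape_pos D θ₀ i) (D.τ_pos i)

/-- The central limit theorem for the residuals. -/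
theorem tendstoInDistribution_residual (hw0 : ∀ i, 0 ≤ w i)
    (hK : Tendsto (fun n => total (K n)) atTop atTop)
    (hw : ∀ i, Tendsto (fun n => weights (K n) i) atTop (𝓝 (w i))) :
    TendstoInDistribution
      (fun n ω => √(total (K n)) • residual D θ₀ (weights (K n)) (failFreq (K n) (N n ω))) atTop
      (fun ξ => diagonal (limitSD D w θ₀) *ᵥ ξ) (fun _ => P) (stdNormal (Fin I)) := by
  have hmeas (n : ℕ) : AEMeasurable (fun ω => WithLp.toLp 2
      (√(total (K n)) • residual D θ₀ (weights (K n)) (failFreq (K n) (N n ω)))) P := by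
    have h : Continuous fun ν : Fin I → ℝ => WithLp.toLp 2
        (√(total (K n)) • residual D θ₀ (weights (K n)) ν) := by
      refine (PiLp.continuous_toLp 2 _).comp ?_
      unfold residual
      fun_prop
    exact h.measurable.comp_aemeasurable (aemeasurable_failFreq D hlaw hN n)
  have key : TendstoInDistribution (fun n ω => WithLp.toLp 2
      (√(total (K n)) • residual D θ₀ (weights (K n)) (failFreq (K n) (N n ω)))) atTop
      (fun ξ => WithLp.toLp 2 (diagonal (limitSD D w θ₀) *ᵥ ξ)) (fun _ => P)
      (stdNormal (Fin I)) := by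
    refine ⟨hmeas, (measurable_toLp_mulVec _).aemeasurable,
      ProbabilityMeasure.tendsto_iff_tendsto_charFun.2 fun t => ?_⟩
    simp only [ProbabilityMeasure.coe_mk]
    simp_rw [charFun_sqrt_smul_residual D hlaw hindep hN, charFun_map_mulVec_stdNormal]
    have e : t.ofLp ⬝ᵥ (diagonal (limitSD D w θ₀) * (diagonal (limitSD D w θ₀))ᵀ) *ᵥ t.ofLp =
        ∑ i, w i * (failProb D θ₀ i * (1 - failProb D θ₀ i)) * t i ^ 2 := by
      rw [diagonal_transpose, diagonal_mul_diagonal]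
      simp only [dotProduct, mulVec_diagonal, limitSD_sq D hw0, ← relProb_eq_one_sub]
      exact Finset.sum_congr rfl fun i _ => by ring
    rw [e]
    push_cast
    rw [neg_div, Finset.sum_div, ← Finset.sum_neg_distrib, Complex.exp_sum]
    refine tendsto_finsetProd _ fun i _ => ?_
    have hs : Tendsto (fun n => (√(total (K n)))⁻¹ * t i) atTop (𝓝 0) := by
      simpa using (tendsto_inv_atTop_zero.comp (Real.tendsto_sqrt_atTop.comp hK)).mul_const (t i)
    have hk : Tendsto (fun n => (K n i : ℝ) * ((√(total (K n)))⁻¹ * t i) ^ 2) atTop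
        (𝓝 (w i * t i ^ 2)) := by
      refine ((hw i).mul_const (t i ^ 2)).congr fun n => ?_
      rw [mul_pow, inv_pow, Real.sq_sqrt (total_nonneg _), weights]
      ring
    have h := tendsto_bernoulliCharFun_pow (p := failProb D θ₀ i) hs hk
    push_cast at h
    rw [← neg_div]
    exact h
  exact key.continuous_comp (g := WithLp.ofLp) (PiLp.continuous_ofLp 2 _)

/-- A weak law of large numbers, read off the central limit theorem by multiplying with `1 / √K`. -/
lemma tendsto_failFreq (hw0 : ∀ i, 0 ≤ w i)
    (hK : Tendsto (fun n => total (K n)) atTop atTop)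
    (hw : ∀ i, Tendsto (fun n => weights (K n) i) atTop (𝓝 (w i))) :
    Tendsto (fun x : ℕ × Ω => failFreq (K x.1) (N x.1 x.2)) (probFilter P)
      (𝓝 fun i => w i * failProb D θ₀ i) := by
  have h := tendstoInDistribution_residual D hlaw hindep hN hw0 hK hw
  have h0 : Tendsto (fun n => (√(total (K n)))⁻¹) atTop (𝓝 0) :=
    tendsto_inv_atTop_zero.comp (Real.tendsto_sqrt_atTop.comp hK)
  have h1 := h.continuous_comp_prodMk_of_tendstoInMeasure_const
    (g := fun p : (Fin I → ℝ) × ℝ => p.2 • p.1) (Y := fun n _ => (√(total (K n)))⁻¹) (c := 0)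
    (by fun_prop) (tendstoInMeasure_const_iff.2 (h0.comp tendsto_fst_probFilter))
    fun n => aemeasurable_const
  simp only [zero_smul] at h1
  have h2 := h1.tendsto_probFilter
  have h3 : Tendsto (fun x : ℕ × Ω => weights (K x.1)) (probFilter P) (𝓝 w) :=
    (tendsto_pi_nhds.2 hw).comp tendsto_fst_probFilter
  have h4 : Tendsto (fun x : ℕ × Ω => fun i => weights (K x.1) i * failProb D θ₀ i)
      (probFilter P) (𝓝 fun i => w i * failProb D θ₀ i) :=
    tendsto_pi_nhds.2 fun i => (tendsto_pi_nhds.1 h3 i).mul_const _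
  have h5 := h2.add h4
  rw [zero_add] at h5
  refine h5.congr' ?_
  filter_upwards [tendsto_fst_probFilter.eventually (hK.eventually_gt_atTop 0)] with x hx
  ext i
  have : √(total (K x.1)) ≠ 0 := (Real.sqrt_pos.2 hx).ne'
  simp [residual, this]

end Sample

end OneShot
end
noncomputable section

/-! ### The chi-squared limit and existence of consistent roots. -/

namespace OneShot

open Matrix

variable {I J r : ℕ} (D : Design I J)

lemma limitVec_smul (m : Params J → Fin r → ℝ) (γ : ℝ) (w : Fin I → ℝ) (θ₀ : Params J) (a : ℝ)
    (y : Fin I → ℝ) : limitVec D m γ w θ₀ (a • y) = a • limitVec D m γ w θ₀ y := by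
  simp only [limitVec, Pi.smul_apply, smul_assoc, ← Finset.smul_sum, mulVec_smul]

lemma limitQuad_smul (m : Params J → Fin r → ℝ) (γ : ℝ) (w : Fin I → ℝ) (θ₀ : Params J) (a : ℝ)
    (y : Fin I → ℝ) : limitQuad D m γ w θ₀ (a • y) = a * a * limitQuad D m γ w θ₀ y := by
  simp only [limitQuad, limitVec_smul, mulVec_smul, dotProduct_smul, smul_dotProduct, smul_eq_mul]
  ring

lemma continuous_limitQuad (m : Params J → Fin r → ℝ) (γ : ℝ) (w : Fin I → ℝ) (θ₀ : Params J) :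
    Continuous (limitQuad D m γ w θ₀) := by
  have h : Continuous (limitVec D m γ w θ₀) :=
    continuous_const.matrix_mulVec (by fun_prop)
  exact h.dotProduct (continuous_const.matrix_mulVec h)

/-- The quadratic form in the limits of the scaled residuals has a chi-squared distribution. -/
lemma map_limitQuad {m : Params J → Fin r → ℝ} {γ : ℝ} {w : Fin I → ℝ} {θ₀ : Params J}
    (hw : ∀ i, 0 ≤ w i) (hJ : IsUnit (matJ D γ w θ₀).det) (hrank : (matM m θ₀).rank = r) :
    (stdNormal (Fin I)).map (fun ξ => limitQuad D m γ w θ₀ (diagonal (limitSD D w θ₀) *ᵥ ξ)) =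
      chiSquared r := by
  -- `H` is a square root of `K` in the sense `H Hᵀ = K`, so `Qᵀ H ξ` has covariance `Qᵀ K Q`.
  set H : Matrix (Fin (J + 1) ⊕ Fin (J + 1)) (Fin I) ℝ :=
    of fun p i => limitSD D w θ₀ i * scoreTerm D γ θ₀ i p with hH
  have hHH : H * Hᵀ = matK D γ w θ₀ := by
    ext p q
    rw [matK_eq, Matrix.sum_apply, mul_apply]
    refine Finset.sum_congr rfl fun i _ => ?_
    simp only [hH, transpose_apply, of_apply, Matrix.smul_apply, vecMulVec_apply, smul_eq_mul,
      ← limitSD_sq D hw]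
    ring
  have hvec (ξ : Fin I → ℝ) : limitVec D m γ w θ₀ (diagonal (limitSD D w θ₀) *ᵥ ξ) =
      ((matQ D m γ w θ₀)ᵀ * H) *ᵥ ξ := by
    rw [limitVec, ← mulVec_mulVec]
    congr 1
    ext p
    simp only [Finset.sum_apply, Pi.smul_apply, mulVec_diagonal, smul_eq_mul]
    simp only [mulVec, dotProduct, hH, of_apply]
    exact Finset.sum_congr rfl fun i _ => by ring
  simp only [limitQuad, hvec]
  refine map_quadraticForm_stdNormal _ (posDef_matB D hw hJ hrank) ?_
  rw [transpose_mul, transpose_transpose, matB, ← hHH]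
  simp only [Matrix.mul_assoc]

lemma isRestrictedRoot_iff {m : Params J → Fin r → ℝ} {γ : ℝ} {K N : Fin I → ℕ} {θ : Params J}
    (hK : 0 < total K) :
    IsRestrictedRoot D m γ K N θ ↔
      (∃ k, meanScore D γ θ (weights K) (failFreq K N) + matM m θ *ᵥ k = 0) ∧ m θ = 0 := by
  refine and_congr_left' ⟨fun ⟨k, hk⟩ => ⟨(total K)⁻¹ • k, ?_⟩, fun ⟨k, hk⟩ =>
    ⟨total K • k, ?_⟩⟩
  · rw [← inv_total_smul_score, mulVec_smul, ← smul_add, hk, smul_zero]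
  · have h := congrArg (total K • ·) hk
    simpa only [smul_add, ← inv_total_smul_score, smul_smul, mul_inv_cancel₀ hK.ne', one_smul,
      smul_zero, mulVec_smul] using h

section Sample

variable {Ω : Type*} [MeasurableSpace Ω] {P : Measure Ω} [IsProbabilityMeasure P]
    {θ₀ : Params J} {K : ℕ → Fin I → ℕ} {w : Fin I → ℝ}
    {T : (n : ℕ) → (i : Fin I) → Fin (K n i) → Ω → ℝ}
    {N : ℕ → Ω → Fin I → ℕ} {m : Params J → Fin r → ℝ} {γ : ℝ}

/-- The limit law of the Rao-type statistic at consistent roots of the restricted estimating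
equations. -/
theorem tendstoInDistribution_raoStat
    (hlaw : ∀ n i k, HasLaw (T n i k) (logLogistic (scale D θ₀ i) (shape D θ₀ i)) P)
    (hindep : ∀ n, iIndepFun (fun p : (Σ i : Fin I, Fin (K n i)) => T n p.1 p.2) P)
    (hN : ∀ n ω, N n ω = failures D (fun i k => T n i k ω))
    (hw0 : ∀ i, 0 ≤ w i) (hK : Tendsto (fun n => total (K n)) atTop atTop)
    (hw : ∀ i, Tendsto (fun n => weights (K n) i) atTop (𝓝 (w i)))
    (hJ : IsUnit (matJ D γ w θ₀).det) (hm : ContDiffAt ℝ 1 m θ₀) (hH0 : m θ₀ = 0)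
    (hrank : (matM m θ₀).rank = r) {θt : ℕ → Ω → Params J} (hmeas : ∀ n, AEMeasurable (θt n) P)
    (hcons : Tendsto (fun x : ℕ × Ω => θt x.1 x.2) (probFilter P) (𝓝 θ₀))
    (hroot : ∀ᶠ x in probFilter P, IsRestrictedRoot D m γ (K x.1) (N x.1 x.2) (θt x.1 x.2)) :
    TendstoInDistribution (fun n ω => raoStat D m γ (K n) (N n ω) (θt n ω)) atTop
      (id : ℝ → ℝ) (fun _ => P) (chiSquared r) := by
  have hc : Tendsto (fun x : ℕ × Ω => weights (K x.1)) (probFilter P) (𝓝 w) :=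
    (tendsto_pi_nhds.2 hw).comp tendsto_fst_probFilter
  have hν := tendsto_failFreq D hlaw hindep hN hw0 hK hw
  have hpos : ∀ᶠ x : ℕ × Ω in probFilter P, 0 < total (K x.1) :=
    tendsto_fst_probFilter.eventually (hK.eventually_gt_atTop 0)
  have hroot' := hpos.and hroot |>.mono fun x hx => (isRestrictedRoot_iff D hx.1).1 hx.2
  have hexp := raoQuad_sub_limitQuad_isLittleO D hw0 hJ hm hH0 hrank hcons hc hν hroot'
  have hX := tendstoInDistribution_residual D hlaw hindep hN hw0 hK hw
  have hR (n : ℕ) : AEMeasurable (fun ω => raoStat D m γ (K n) (N n ω) (θt n ω)) P := by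
    simp only [raoStat_eq]
    exact ((measurable_raoQuad D m γ (weights (K n))).comp_aemeasurable
      ((aemeasurable_failFreq D hlaw hN n).prodMk (hmeas n))).const_mul _
  -- The factor `total K` is absorbed into the residuals, the quadratic form being homogeneous of
  -- degree two.
  have h := hX.of_sub_isLittleO (continuous_limitQuad D m γ w θ₀) hR ?_
  · refine h.congr_limit aemeasurable_id ?_
    rw [map_limitQuad D hw0 hJ hrank, Measure.map_id]
  · refine ((Asymptotics.isBigO_refl (fun x : ℕ × Ω => total (K x.1)) _).mul_isLittleO
      hexp).congr (fun x => ?_) fun x => ?_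
    · rw [raoStat_eq, limitQuad_smul, Real.mul_self_sqrt (total_nonneg _)]
      ring
    · rw [norm_smul, Real.norm_of_nonneg (Real.sqrt_nonneg _), mul_mul_mul_comm,
        Real.mul_self_sqrt (total_nonneg _)]

omit [IsProbabilityMeasure P] in
lemma eventually_isRestrictedRoot
    (hN : ∀ n ω, N n ω = failures D (fun i k => T n i k ω)) (hγ : 0 ≤ γ)
    (hw0 : ∀ i, 0 ≤ w i) (hK : Tendsto (fun n => total (K n)) atTop atTop)
    (hJ : IsUnit (matJ D γ w θ₀).det) (hm : ContDiffAt ℝ 1 m θ₀)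
    (hrank : (matM m θ₀).rank = r) {θt : ℕ → Ω → Params J}
    (hcons : Tendsto (fun x : ℕ × Ω => θt x.1 x.2) (probFilter P) (𝓝 θ₀))
    (hmin : ∀ᶠ x in probFilter P, m (θt x.1 x.2) = 0 ∧
      IsLocalMinOn (objective D γ (K x.1) (N x.1 x.2)) {θ | m θ = 0} (θt x.1 x.2)) :
    ∀ᶠ x in probFilter P, IsRestrictedRoot D m γ (K x.1) (N x.1 x.2) (θt x.1 x.2) := by
  filter_upwards [hmin, tendsto_fst_probFilter.eventually (hK.eventually_gt_atTop 0),
    hcons.eventually (eventually_exists_multipliers D hγ hw0 hJ hm hrank)] with x ⟨h1, h2⟩ h3 h4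
  rw [funext (objective_eq D γ _ _ (failures_le D hN x.1 x.2))] at h2
  exact (isRestrictedRoot_iff D h3).2 ⟨h4 _ _ h1 h2, h1⟩

/-- `A` is the whole restricted set in the well-separated case and a compact piece of it in the
existence proof. -/
lemma tendsto_of_isMinOn
    (hlaw : ∀ n i k, HasLaw (T n i k) (logLogistic (scale D θ₀ i) (shape D θ₀ i)) P)
    (hindep : ∀ n, iIndepFun (fun p : (Σ i : Fin I, Fin (K n i)) => T n p.1 p.2) P)
    (hN : ∀ n ω, N n ω = failures D (fun i k => T n i k ω)) (hγ : 0 ≤ γ)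
    (hw0 : ∀ i, 0 ≤ w i) (hK : Tendsto (fun n => total (K n)) atTop atTop)
    (hw : ∀ i, Tendsto (fun n => weights (K n) i) atTop (𝓝 (w i)))
    {A : Set (Params J)} (hA : θ₀ ∈ A)
    (hsep : ∀ ε > 0, ∃ δ > 0, ∀ θ ∈ A, ε ≤ dist θ θ₀ →
      limitObjective D γ w θ₀ θ₀ + δ ≤ limitObjective D γ w θ₀ θ)
    {θt : ℕ → Ω → Params J}
    (hmin : ∀ᶠ x in probFilter P, θt x.1 x.2 ∈ A ∧
      IsMinOn (objective D γ (K x.1) (N x.1 x.2)) A (θt x.1 x.2)) :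
    Tendsto (fun x : ℕ × Ω => θt x.1 x.2) (probFilter P) (𝓝 θ₀) := by
  rw [Metric.tendsto_nhds]
  intro ε hε
  have hc : Tendsto (fun x : ℕ × Ω => weights (K x.1)) (probFilter P) (𝓝 w) :=
    (tendsto_pi_nhds.2 hw).comp tendsto_fst_probFilter
  have hadm : ∀ᶠ x : ℕ × Ω in probFilter P, ∀ i, 0 ≤ failFreq (K x.1) (N x.1 x.2) i ∧
      failFreq (K x.1) (N x.1 x.2) i ≤ weights (K x.1) i :=
    Eventually.of_forall fun x i => ⟨div_nonneg (by positivity) (total_nonneg _),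
      div_le_div_of_nonneg_right (by exact_mod_cast failures_le D hN x.1 x.2 i) (total_nonneg _)⟩
  filter_upwards [hmin, eventually_dist_lt_of_isMinOn D hγ hw0 hc
    (tendsto_failFreq D hlaw hindep hN hw0 hK hw) hadm hA hsep hε] with x ⟨h1, h2⟩ h3
  rw [funext (objective_eq D γ _ _ (failures_le D hN x.1 x.2))] at h2
  exact h3 _ h1 h2

/-- Minimizers of the objective function over a neighbourhood of the true parameter in the
restricted parameter space are consistent roots of the restricted estimating equations. -/
theorem exists_consistent_root
    (hlaw : ∀ n i k, HasLaw (T n i k) (logLogistic (scale D θ₀ i) (shape D θ₀ i)) P)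
    (hindep : ∀ n, iIndepFun (fun p : (Σ i : Fin I, Fin (K n i)) => T n p.1 p.2) P)
    (hN : ∀ n ω, N n ω = failures D (fun i k => T n i k ω)) (hγ : 0 ≤ γ)
    (hw0 : ∀ i, 0 ≤ w i) (hK : Tendsto (fun n => total (K n)) atTop atTop)
    (hw : ∀ i, Tendsto (fun n => weights (K n) i) atTop (𝓝 (w i)))
    (hJ : IsUnit (matJ D γ w θ₀).det) (hm : ContDiffAt ℝ 1 m θ₀) (hH0 : m θ₀ = 0)
    (hrank : (matM m θ₀).rank = r) :
    ∃ est : ℕ → (Fin I → ℕ) → Params J,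
      Tendsto (fun x : ℕ × Ω => est x.1 (N x.1 x.2)) (probFilter P) (𝓝 θ₀) ∧
      ∀ᶠ x in probFilter P, IsRestrictedRoot D m γ (K x.1) (N x.1 x.2) (est x.1 (N x.1 x.2)) ∧
        IsLocalMinOn (objective D γ (K x.1) (N x.1 x.2)) {θ | m θ = 0} (est x.1 (N x.1 x.2)) := by
  have hev : ∀ᶠ θ in 𝓝 θ₀, ContinuousAt m θ ∧
      (θ ≠ θ₀ → limitObjective D γ w θ₀ θ₀ < limitObjective D γ w θ₀ θ) :=
    ((hm.eventually (by simp)).mono fun θ h => h.continuousAt).and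
      (eventually_nhdsWithin_iff.1 (eventually_limitObjective_lt D hγ hw0 hJ))
  obtain ⟨ρ, hρ, hball⟩ := Metric.nhds_basis_closedBall.eventually_iff.1 hev
  set A := Metric.closedBall θ₀ ρ ∩ {θ | m θ = 0}
  have hA : θ₀ ∈ A := ⟨Metric.mem_closedBall_self hρ.le, hH0⟩
  have hAc : IsCompact A := by
    have hcont : ContinuousOn m (Metric.closedBall θ₀ ρ) :=
      fun θ hθ => (hball hθ).1.continuousWithinAt
    exact (isCompact_closedBall θ₀ ρ).of_isClosed_subset
      (hcont.preimage_isClosed_of_isClosed Metric.isClosed_closedBall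
        (isClosed_singleton (x := (0 : Fin r → ℝ)))) Set.inter_subset_left
  -- The choice depends on the counts alone; for counts without a minimizer it is an arbitrary
  -- point.
  set est : ℕ → (Fin I → ℕ) → Params J := fun n k =>
    Classical.epsilon fun θ => θ ∈ A ∧ IsMinOn (objective D γ (K n) k) A θ
  have hspec (x : ℕ × Ω) : est x.1 (N x.1 x.2) ∈ A ∧
      IsMinOn (objective D γ (K x.1) (N x.1 x.2)) A (est x.1 (N x.1 x.2)) := by
    refine Classical.epsilon_spec
      (p := fun θ => θ ∈ A ∧ IsMinOn (objective D γ (K x.1) (N x.1 x.2)) A θ) ?_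
    refine hAc.exists_isMinOn ⟨θ₀, hA⟩ ?_
    rw [funext (objective_eq D γ _ _ (failures_le D hN x.1 x.2))]
    exact (continuous_freqObjective D γ _ _).continuousOn
  have hsep : ∀ ε > 0, ∃ δ > 0, ∀ θ ∈ A, ε ≤ dist θ θ₀ →
      limitObjective D γ w θ₀ θ₀ + δ ≤ limitObjective D γ w θ₀ θ := fun ε hε => by
    obtain ⟨δ, hδ, h⟩ := separated_on_closedBall D (fun θ hθ => (hball hθ).2) hε
    exact ⟨δ, hδ, fun θ hθ => h θ hθ.1⟩
  clear_value est
  have hcons := tendsto_of_isMinOn (θt := fun n ω => est n (N n ω)) D hlaw hindep hN hγ hw0 hK hw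
    hA hsep (Eventually.of_forall hspec)
  have hmin : ∀ᶠ x in probFilter P,
      IsLocalMinOn (objective D γ (K x.1) (N x.1 x.2)) {θ | m θ = 0} (est x.1 (N x.1 x.2)) := by
    -- Consistency puts the estimator in the open ball, where minimality over `A` is local
    -- minimality on the restricted set.
    filter_upwards [hcons.eventually (Metric.ball_mem_nhds θ₀ hρ)] with x hx
    refine (hspec x).2.filter_mono (le_principal_iff.2 ?_)
    exact inter_mem (mem_nhdsWithin_of_mem_nhds (mem_of_superset
      (Metric.isOpen_ball.mem_nhds hx) Metric.ball_subset_closedBall)) self_mem_nhdsWithin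
  exact ⟨est, hcons, (eventually_isRestrictedRoot
    (θt := fun n ω => est n (N n ω)) D hN hγ hw0 hK hJ hm hrank hcons (hmin.mono fun x hx => ⟨(hspec x).1.2, hx⟩)).and hmin⟩

end Sample

end OneShot

end

theorem mainTheorem4 {I J r : ℕ} (D : OneShot.Design I J) (γ : ℝ) (hγ : 0 ≤ γ)
    -- the restrictions and the true parameter, under the null hypothesis
    (m : OneShot.Params J → Fin r → ℝ) (θ₀ : OneShot.Params J)
    (hH0 : m θ₀ = 0)
    (hm : ContDiffAt ℝ 1 m θ₀)
    (hrank : (OneShot.matM m θ₀).rank = r)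
    -- the numbers of devices
    (K : ℕ → Fin I → ℕ) (w : Fin I → ℝ)
    (hK : Tendsto (fun n => OneShot.total (K n)) atTop atTop)
    (hw : ∀ i, Tendsto (fun n => OneShot.weights (K n) i) atTop (𝓝 (w i)))
    (hJ : IsUnit (OneShot.matJ D γ w θ₀).det)
    -- the lifetimes
    {Ω : Type*} [MeasurableSpace Ω] (P : Measure Ω) [IsProbabilityMeasure P]
    (T : (n : ℕ) → (i : Fin I) → Fin (K n i) → Ω → ℝ)
    (hlaw : ∀ n i k,
      HasLaw (T n i k) (OneShot.logLogistic (OneShot.scale D θ₀ i) (OneShot.shape D θ₀ i)) P)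
    (hindep : ∀ n, iIndepFun (fun p : (Σ i : Fin I, Fin (K n i)) => T n p.1 p.2) P)
    -- the numbers of failures
    (N : ℕ → Ω → Fin I → ℕ)
    (hN : ∀ n ω, N n ω = OneShot.failures D (fun i k => T n i k ω)) :
    -- consistent roots of the restricted estimating equations exist
    (∃ est : ℕ → (Fin I → ℕ) → OneShot.Params J,
      TendstoInMeasure P (fun n ω => est n (N n ω)) atTop (fun _ => θ₀) ∧
      Tendsto (fun n => P {ω | ¬ (OneShot.IsRestrictedRoot D m γ (K n) (N n ω) (est n (N n ω)) ∧
        IsLocalMinOn (OneShot.objective D γ (K n) (N n ω)) {θ | m θ = 0} (est n (N n ω)))})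
        atTop (𝓝 0)) ∧
    -- the Rao-type statistic at every consistent sequence of roots
    (∀ θt : ℕ → Ω → OneShot.Params J, (∀ n, AEMeasurable (θt n) P) →
      TendstoInMeasure P θt atTop (fun _ => θ₀) →
      Tendsto (fun n => P {ω | ¬ OneShot.IsRestrictedRoot D m γ (K n) (N n ω) (θt n ω)})
        atTop (𝓝 0) →
      TendstoInDistribution (fun n ω => OneShot.raoStat D m γ (K n) (N n ω) (θt n ω)) atTop
        (id : ℝ → ℝ) (fun _ => P) (OneShot.chiSquared r)) ∧
    -- the Rao-type statistic at the minimizers over the restricted parameter space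
    (∀ θt : ℕ → Ω → OneShot.Params J, (∀ n, AEMeasurable (θt n) P) →
      Tendsto (fun n => P {ω | ¬ OneShot.IsRWMDPDE D m γ (K n) (N n ω) (θt n ω)})
        atTop (𝓝 0) →
      (TendstoInMeasure P θt atTop (fun _ => θ₀) ∨ OneShot.IsWellSeparated D m γ w θ₀) →
      TendstoInDistribution (fun n ω => OneShot.raoStat D m γ (K n) (N n ω) (θt n ω)) atTop
        (id : ℝ → ℝ) (fun _ => P) (OneShot.chiSquared r)) := by
  have hw0 : ∀ i, 0 ≤ w i := fun i =>
    ge_of_tendsto' (hw i) fun n => OneShot.weights_nonneg (K n) i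
  refine ⟨?_, fun θt hmeas hcons hroot => ?_, fun θt hmeas hmin hcons => ?_⟩
  · obtain ⟨est, hcons, hroot⟩ := OneShot.exists_consistent_root D hlaw hindep hN hγ hw0 hK hw hJ
      hm hH0 hrank
    exact ⟨est, tendstoInMeasure_const_iff.2 hcons, hroot⟩
  · exact OneShot.tendstoInDistribution_raoStat D hlaw hindep hN hw0 hK hw hJ hm hH0 hrank hmeas
      (tendstoInMeasure_const_iff.1 hcons) (eventually_probFilter.2 hroot)
  · have hmin' : ∀ᶠ x in probFilter P,
        OneShot.IsRWMDPDE D m γ (K x.1) (N x.1 x.2) (θt x.1 x.2) := eventually_probFilter.2 hmin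
    have hcons' : Tendsto (fun x : ℕ × Ω => θt x.1 x.2) (probFilter P) (𝓝 θ₀) := by
      rcases hcons with hcons | hsep
      · exact tendstoInMeasure_const_iff.1 hcons
      · refine OneShot.tendsto_of_isMinOn D hlaw hindep hN hγ hw0 hK hw (A := {θ | m θ = 0}) hH0
          (fun ε hε => ?_) hmin'
        obtain ⟨δ, hδ, h⟩ := hsep ε hε
        refine ⟨δ, hδ, fun θ hθ hd => ?_⟩
        simpa only [OneShot.weightedDPD_modelProb, OneShot.limitObjective] using h θ hθ hd
    exact OneShot.tendstoInDistribution_raoStat D hlaw hindep hN hw0 hK hw hJ hm hH0 hrank hmeas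
      hcons' (OneShot.eventually_isRestrictedRoot D hN hγ hw0 hK hJ hm hrank hcons'
        (hmin'.mono fun x hx => ⟨hx.1, hx.2.localize⟩))
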